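/- **Model.** Work is the total number of unit-time instructions executed by all processors, and depth is the length of the longest chain of sequentially dependent instructions. A parallel loop or a reduction, compaction or copy over $k$ array entries costs $O(k)$ work and $O(\log k)$ depth in addition to the work (summed) and depth (maximised) of its branches. The input is a simple undirected graph $G$ with $n$ vertices and $m$ edges, given by arrays of neighbours. The degeneracy $d$ of $G$ is the smallest number such that every nonempty subgraph of $G$ has a vertex of degree at most $d$. **Algorithm BK-ADG.** Fix $\varepsilon>0$. 1. *Approximate degeneracy order.* Start with $U=V$. In round $i=1,2,\dots$, as long as $U\neq\emptyset$, give rank $i$ to all vertices of $U$ whose degree in $G[U]$ is at most $(1+\varepsilon/2)$ times the average degree of $G[U]$, and remove them from $U$. Order $V$ by rank, ties broken by vertex number. This is a $(2+\varepsilon)$-approximate degeneracy order: every vertex has at most $(2+\varepsilon)d$ neighbours later in the order. 2. *Enumeration.* For all vertices $v$ in parallel, let $P$ and $X$ be the sets of neighbours of $v$ that follow and precede $v$ in this order, build the subgraph $H$ on $P\cup X$ that consists of the edges with an endpoint in $P$, and call BK-Pivot$(P,\{v\},X)$. All set operations in BK-Pivot use $H$. BK-Pivot$(P,R,X)$ reports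 $R$ if $P\cup X=\emptyset$. Otherwise it chooses a pivot $u\in P\cup X$ that minimises $|P\setminus N(u)|$, and for the vertices $v_1<\dots<v_k$ of $P\setminus N(u)$, in parallel, calls BK-Pivot$(P_j\cap N(v_j),\,R\cup\{v_j\},\,X_j\cap N(v_j))$, where $P_j=P\setminus\{v_1,\dots,v_{j-1}\}$ and $X_j=X\cup\{v_1,\dots,v_{j-1}\}$. **Lemma.** For every constant $\varepsilon>0$ and every graph with $n\ge 2$ vertices, BK-ADG reports every maximal clique exactly once and nothing else. It takes $$O\!\left(d\,m\,3^{(2+\varepsilon)d/3}\right)\ \text{work}\qquad\text{and}\qquad O\!\left(\log^2 n+d\log n\right)\ \text{depth},$$ where the work bound, which includes the work for writing the output, is for graphs with $n=O(m)$, that is, $n\le c\,m$ for a constant $c$ (for instance, $c=2$ for graphs without isolated vertices). The constants hidden in the bounds depend only on $\varepsilon$ and $c$. -/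

import Mathlib

/-! ### The work-depth model

A computation with nested parallelism is recorded by its result, the total number of
instructions executed by all processors (`work`), the length of the longest chain of
sequentially dependent instructions (`depth`), and the multiset of objects it has written to
the output.  All costs below are charged by the primitives; `pure` only passes on a
value that has already been computed. Sequences (`List`) stand for arrays with constant time access
to their length and entries, and functions `Fin n → β` for arrays indexed by vertices. -/

structure Comp (ω α : Type) where
  val : α
  work : ℕ
  depth : ℕ
  out : Multiset ω

namespace Comp

variable {ω α β : Type}

/-- Sequential composition: work and depth are both additive. -/
instance : Monad (Comp ω) where
  pure a := ⟨a, 0, 0, 0⟩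
  bind x f := ⟨(f x.val).val, x.work + (f x.val).work, x.depth + (f x.val).depth,
    x.out + (f x.val).out⟩

/-- A single machine instruction (memory access, comparison, arithmetic, list node creation)
that delivers `a`. -/
def instr (a : α) : Comp ω α := ⟨a, 1, 1, 0⟩

/-- Write the object `o`, which occupies `size` memory cells, to the output. -/
def emit (o : ω) (size : ℕ) : Comp ω Unit := ⟨(), 1 + size, 1 + size, {o}⟩

/-- Parallel loop. The branches run simultaneously: the work is the sum of the work of the branches
plus one instruction per branch, and the depth is the maximal depth of a branch
plus the height of a balanced binary tree that forks and joins the branches. -/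
def parMap (f : α → Comp ω β) (l : List α) : Comp ω (List β) where
  val := l.map fun a => (f a).val
  work := 1 + (l.map fun a => 1 + (f a).work).sum
  depth := 1 + Nat.clog 2 l.length + (l.map fun a => (f a).depth).foldr max 0
  out := (l.map fun a => (f a).out).sum

/-- Reduction of an array by an associative constant time operation:
linear work and logarithmic depth. -/
def reduce (op : α → α → α) (e : α) (l : List α) : Comp ω α :=
  ⟨l.foldr op e, 1 + l.length, 1 + Nat.clog 2 l.length, 0⟩

/-- Packing (array compaction by prefix sums): keep the entries whose flag is set.
Linear work and logarithmic depth. -/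
def pack (l : List (α × Bool)) : Comp ω (List α) :=
  ⟨(l.filter Prod.snd).map Prod.fst, 1 + l.length, 1 + Nat.clog 2 l.length, 0⟩

/-- Concatenation of two arrays by copying all entries in parallel. -/
def concat (l₁ l₂ : List α) : Comp ω (List α) :=
  ⟨l₁ ++ l₂, 1 + (l₁.length + l₂.length), 1 + Nat.clog 2 (l₁.length + l₂.length), 0⟩

/-- Parallel loop over the vertices in `l` that stores the result of the branch `v` in
cell `v` of the vertex-indexed array `old`; the other cells keep their contents. -/
def store {n : ℕ} (l : List (Fin n)) (f : Fin n → Comp ω β) (old : Fin n → β) :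
    Comp ω (Fin n → β) where
  val := fun v => if v ∈ l then (f v).val else old v
  work := 1 + (l.map fun v => 2 + (f v).work).sum
  depth := 2 + Nat.clog 2 l.length + (l.map fun v => (f v).depth).foldr max 0
  out := (l.map fun v => (f v).out).sum

/-- The array of all vertices. -/
def vertices (n : ℕ) : Comp ω (List (Fin n)) :=
  ⟨List.finRange n, 1 + n, 1 + Nat.clog 2 n, 0⟩

/-- Select in parallel the entries of an array that pass a test. -/
def parFilter (p : α → Comp ω Bool) (l : List α) : Comp ω (List α) := do
  let flagged ← parMap (fun a => do
    let b ← p a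
    instr (a, b)) l
  pack flagged

/-- Count in parallel the entries of an array that pass a test. -/
def parCount (p : α → Comp ω Bool) (l : List α) : Comp ω ℕ := do
  let ones ← parMap (fun a => do
    let b ← p a
    instr (if b then 1 else 0)) l
  reduce (· + ·) 0 ones

/-- Test by a parallel scan whether `a` occurs in the unsorted array `l`. -/
def parMem [DecidableEq α] (a : α) (l : List α) : Comp ω Bool := do
  let hits ← parMap (fun b => instr (decide (b = a))) l
  reduce (· || ·) false hits

end Comp

/-! ### The approximate degeneracy order -/

section ADG

open Comp

variable {ω : Type} {n : ℕ}

/-- The rounds of the approximate degeneracy ordering. `U` is the current working set, `N v` is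
the array of the neighbours of `v ∈ U` inside `U`, `i` is the number of the round, and `η` is the
array of the ranks assigned so far (`0` means that no rank has been assigned).
In each round all vertices of `U` whose degree
inside `U` is at most `1 + δ` times the average degree inside `U` receive the rank `i` and
leave `U`; the rounds stop when `U` is empty. The first argument bounds the number of rounds. -/
noncomputable def adgLoop (δ : ℝ) : ℕ → ℕ → List (Fin n) → (Fin n → List (Fin n)) →
    (Fin n → ℕ) → Comp ω (Fin n → ℕ)
  | 0, _, _, _, η => pure η
  | fuel + 1, i, U, N, η => do
    let done ← instr U.isEmpty
    if done then pure η
    else do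
      let degrees ← parMap (fun v => instr (N v).length) U
      let total ← reduce (· + ·) 0 degrees
      let average ← instr ((total : ℝ) / (U.length : ℝ))
      let R ← parFilter (fun v => do
        let deg ← instr (N v).length
        instr (decide ((deg : ℝ) ≤ (1 + δ) * average))) U
      let η' ← store R (fun _ => instr i) η
      let U' ← parFilter (fun v => instr (η' v == 0)) U
      let N' ← store U' (fun v => do
        let Nv ← instr (N v)
        parFilter (fun w => instr (η' w == 0)) Nv) N
      let i' ← instr (i + 1)
      adgLoop δ fuel i' U' N' η'

/-- The approximate degeneracy ordering of the graph with adjacency arrays `A`. At least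
one vertex leaves the working set in every round, so `n` rounds are always enough. -/
noncomputable def adg (δ : ℝ) (A : Fin n → List (Fin n)) : Comp ω (Fin n → ℕ) := do
  let V ← vertices n
  let η₀ ← store V (fun _ => instr 0) (fun _ => 0)
  let N₀ ← store V (fun v => instr (A v)) (fun _ => [])
  adgLoop δ n 1 V N₀ η₀

/-- Does `v` precede `w` in the order by rank? Vertices of equal rank are ordered
by their number. -/
def before (η : Fin n → ℕ) (v w : Fin n) : Comp ω Bool := do
  let a ← instr (η v)
  let b ← instr (η w)
  instr (decide (a < b ∨ (a = b ∧ v < w)))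

end ADG

/-! ### Bron-Kerbosch with pivoting -/

section BK

open Comp

variable {n : ℕ}

/-- A vertex in one of the sets `P` and `X`, together with the array of its neighbours in the
subgraph `H` that is built for the current vertex of the outermost loop. Only the neighbours in
the outermost set `P` are kept, since no others are ever inspected. -/
structure Cand (n : ℕ) where
  vtx : Fin n
  nbr : List (Fin n)

/-- `BK-Pivot(P, R, X)`. If `P ∪ X = ∅`, then `R` is reported. Otherwise a pivot `u ∈ P ∪ X` with
the largest `|P ∩ N(u)|`, that is, the smallest `|P \ N(u)|`, is chosen, and there is one recursive
call for each `v ∈ Q = P \ N(u)`. The recursive calls run in parallel; the one for `v` works on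
the sets that the sequential loop over `Q`, in increasing order, has
when it reaches `v`: the vertices of `Q` before `v` have moved from `P` to `X`.
The first argument bounds the recursion depth. -/
def bkPivot : ℕ → List (Cand n) → List (Fin n) → List (Cand n) → Comp (Finset (Fin n)) Unit
  | 0, _, _, _ => pure ()
  | fuel + 1, P, R, X => do
    let S ← concat P X
    let first ← instr S.head?
    match first with
    | none => emit R.toFinset R.length
    | some s => do
      let scored ← parMap (fun u => do
        let k ← parCount (fun w => parMem w.vtx u.nbr) P
        instr (u, k)) S
      let best ← reduce (fun a b => if a.2 < b.2 then b else a) (s, 0) scored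
      let u ← instr best.1
      let Q ← parFilter (fun w => do
        let b ← parMem w.vtx u.nbr
        instr (!b)) P
      let K ← parFilter (fun w => parMem w.vtx u.nbr) P
      let _ ← parMap (fun v => do
        let later ← parFilter (fun w => instr (decide (v.vtx < w.vtx))) Q
        let earlier ← parFilter (fun w => instr (decide (w.vtx < v.vtx))) Q
        let Pv ← concat K later
        let Xv ← concat X earlier
        let Pnew ← parFilter (fun w => parMem v.vtx w.nbr) Pv
        let Xnew ← parFilter (fun w => parMem v.vtx w.nbr) Xv
        let Rnew ← instr (v.vtx :: R)
        bkPivot fuel Pnew Rnew Xnew) Q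
      pure ()

/-- The neighbours of `w` in `P`. Here `out v` is the array of the neighbours of `v` that
follow `v` in the vertex order, so `w` and `p` are adjacent exactly if `p` occurs in `out w` or
`w` occurs in `out p`. -/
def attach (out : Fin n → List (Fin n)) (P : List (Fin n)) (w : Fin n) :
    Comp (Finset (Fin n)) (Cand n) := do
  let outw ← instr (out w)
  let nbr ← parFilter (fun p => do
    let b ← parMem p outw
    let outp ← instr (out p)
    let c ← parMem w outp
    instr (b || c)) P
  instr ⟨w, nbr⟩

/-- `BK-ADG` on the graph with adjacency arrays `A`: compute the approximate
degeneracy order with threshold `1 + ε / 2` times the average degree, which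
is a `(2 + ε)`-approximate degeneracy order; then, for all vertices `v` in parallel, call
`BK-Pivot(P, {v}, X)`, where `P` and `X` consist of the neighbours of `v` that follow and precede
`v`, respectively. As `P` shrinks in every recursive call, the bound `n` on the
depth of the recursion is never reached prematurely. -/
noncomputable def bkADG (ε : ℝ) (A : Fin n → List (Fin n)) : Comp (Finset (Fin n)) Unit := do
  let η ← adg (ε / 2) A
  let V ← vertices n
  let out ← store V (fun v => do
    let Nv ← instr (A v)
    parFilter (fun w => before η v w) Nv) (fun _ => [])
  let _ ← parMap (fun v => do
    let Nv ← instr (A v)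
    let P₀ ← parFilter (fun w => before η v w) Nv
    let X₀ ← parFilter (fun w => before η w v) Nv
    let P ← parMap (attach out P₀) P₀
    let X ← parMap (attach out P₀) X₀
    let R ← instr [v]
    bkPivot n P R X) V
  pure ()

end BK

/-! ### Graph notions -/

/-- `A` is an adjacency array representation of `G`: for each vertex, the array
of its neighbours, in any order and without repetitions. -/
def IsAdjacencyArrays {n : ℕ} (G : SimpleGraph (Fin n)) (A : Fin n → List (Fin n)) : Prop :=
  ∀ v, (A v).Nodup ∧ ∀ w, w ∈ A v ↔ G.Adj v w

/-- The smallest `d` such that every (nonempty) subgraph of `G` has a vertex of degree at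
most `d`. -/
noncomputable def degeneracy {V : Type*} (G : SimpleGraph V) : ℕ :=
  sInf {d : ℕ | ∀ H : G.Subgraph, H.verts.Nonempty → ∃ v ∈ H.verts, (H.neighborSet v).ncard ≤ d}

open Classical in
/-- The set of all maximal cliques of `G`. -/
noncomputable def maximalCliques {V : Type*} [Fintype V] (G : SimpleGraph V) :
    Finset (Finset V) :=
  Finset.univ.filter fun K => Maximal (fun S : Finset V => G.IsClique (S : Set V)) K

/-! ### Costs of the primitives -/

namespace Comp

variable {ω α β : Type}

@[simp] lemma bind_val (x : Comp ω α) (f : α → Comp ω β) : (x >>= f).val = (f x.val).val := rfl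

@[simp] lemma bind_work (x : Comp ω α) (f : α → Comp ω β) :
    (x >>= f).work = x.work + (f x.val).work := rfl

@[simp] lemma bind_depth (x : Comp ω α) (f : α → Comp ω β) :
    (x >>= f).depth = x.depth + (f x.val).depth := rfl

@[simp] lemma bind_out (x : Comp ω α) (f : α → Comp ω β) :
    (x >>= f).out = x.out + (f x.val).out := rfl

@[simp] lemma pure_val (a : α) : (pure a : Comp ω α).val = a := rfl

@[simp] lemma pure_work (a : α) : (pure a : Comp ω α).work = 0 := rfl

@[simp] lemma pure_depth (a : α) : (pure a : Comp ω α).depth = 0 := rfl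

@[simp] lemma pure_out (a : α) : (pure a : Comp ω α).out = 0 := rfl

@[simp] lemma instr_val (a : α) : (instr a : Comp ω α).val = a := rfl

@[simp] lemma instr_work (a : α) : (instr a : Comp ω α).work = 1 := rfl

@[simp] lemma instr_depth (a : α) : (instr a : Comp ω α).depth = 1 := rfl

@[simp] lemma instr_out (a : α) : (instr a : Comp ω α).out = 0 := rfl

lemma sum_map_le_mul {l : List α} {f : α → ℕ} {b : ℕ} (h : ∀ a ∈ l, f a ≤ b) :
    (l.map f).sum ≤ l.length * b := by
  have := List.sum_le_card_nsmul (l.map f) b (by simpa using h)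
  simpa using this

lemma foldr_max_le {l : List α} {f : α → ℕ} {b : ℕ} (h : ∀ a ∈ l, f a ≤ b) :
    (l.map f).foldr max 0 ≤ b := by
  induction l with
  | nil => simp
  | cons a l ih =>
    simp only [List.map_cons, List.foldr_cons, max_le_iff]
    exact ⟨h a (by simp), ih fun x hx => h x (by simp [hx])⟩

lemma sum_map_const_add (l : List α) (f : α → ℕ) (k : ℕ) :
    (l.map fun a => k + f a).sum = k * l.length + (l.map f).sum := by
  induction l with
  | nil => simp
  | cons a l ih => simp [ih]; ring

lemma sum_map_eq_zero {l : List α} {f : α → Multiset ω} (h : ∀ a ∈ l, f a = 0) :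
    (l.map f).sum = 0 := by
  rw [List.map_congr_left h]; simp

@[simp] lemma parMap_val (f : α → Comp ω β) (l : List α) :
    (parMap f l).val = l.map fun a => (f a).val := rfl

@[simp] lemma parMap_out (f : α → Comp ω β) (l : List α) :
    (parMap f l).out = (l.map fun a => (f a).out).sum := rfl

lemma parMap_work (f : α → Comp ω β) (l : List α) :
    (parMap f l).work = 1 + l.length + (l.map fun a => (f a).work).sum := by
  simp only [parMap, sum_map_const_add]; ring

lemma parMap_work_le {f : α → Comp ω β} {l : List α} {b : ℕ} (h : ∀ a ∈ l, (f a).work ≤ b) :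
    (parMap f l).work ≤ 1 + l.length * (1 + b) := by
  have := sum_map_le_mul h
  rw [parMap_work]; linarith

lemma parMap_depth_le {f : α → Comp ω β} {l : List α} {b N : ℕ} (hN : l.length ≤ N)
    (h : ∀ a ∈ l, (f a).depth ≤ b) : (parMap f l).depth ≤ 1 + Nat.clog 2 N + b := by
  have h1 := Nat.clog_mono_right 2 hN
  have h2 := foldr_max_le h
  simp only [parMap]; omega

@[simp] lemma reduce_val (op : α → α → α) (e : α) (l : List α) :
    (reduce op e l : Comp ω α).val = l.foldr op e := rfl

@[simp] lemma reduce_work (op : α → α → α) (e : α) (l : List α) :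
    (reduce op e l : Comp ω α).work = 1 + l.length := rfl

@[simp] lemma reduce_out (op : α → α → α) (e : α) (l : List α) :
    (reduce op e l : Comp ω α).out = 0 := rfl

lemma reduce_depth_le (op : α → α → α) (e : α) {l : List α} {N : ℕ} (hN : l.length ≤ N) :
    (reduce op e l : Comp ω α).depth ≤ 1 + Nat.clog 2 N :=
  Nat.add_le_add_left (Nat.clog_mono_right 2 hN) 1

@[simp] lemma concat_val (l₁ l₂ : List α) : (concat l₁ l₂ : Comp ω (List α)).val = l₁ ++ l₂ := rfl

@[simp] lemma concat_work (l₁ l₂ : List α) :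
    (concat l₁ l₂ : Comp ω (List α)).work = 1 + (l₁.length + l₂.length) := rfl

@[simp] lemma concat_out (l₁ l₂ : List α) : (concat l₁ l₂ : Comp ω (List α)).out = 0 := rfl

lemma concat_depth_le {l₁ l₂ : List α} {N : ℕ} (hN : l₁.length + l₂.length ≤ N) :
    (concat l₁ l₂ : Comp ω (List α)).depth ≤ 1 + Nat.clog 2 N :=
  Nat.add_le_add_left (Nat.clog_mono_right 2 hN) 1

@[simp] lemma vertices_val (n : ℕ) : (vertices n : Comp ω _).val = List.finRange n := rfl

@[simp] lemma vertices_work (n : ℕ) : (vertices n : Comp ω _).work = 1 + n := rfl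

@[simp] lemma vertices_depth (n : ℕ) : (vertices n : Comp ω _).depth = 1 + Nat.clog 2 n := rfl

@[simp] lemma vertices_out (n : ℕ) : (vertices n : Comp ω _).out = 0 := rfl

section store

variable {n : ℕ}

@[simp] lemma store_val (l : List (Fin n)) (f : Fin n → Comp ω β) (old : Fin n → β) :
    (store l f old).val = fun v => if v ∈ l then (f v).val else old v := rfl

@[simp] lemma store_out (l : List (Fin n)) (f : Fin n → Comp ω β) (old : Fin n → β) :
    (store l f old).out = (l.map fun v => (f v).out).sum := rfl

lemma store_work (l : List (Fin n)) (f : Fin n → Comp ω β) (old : Fin n → β) :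
    (store l f old).work = 1 + 2 * l.length + (l.map fun v => (f v).work).sum := by
  simp only [store, sum_map_const_add]; ring

lemma store_depth_le {l : List (Fin n)} {f : Fin n → Comp ω β} {old : Fin n → β} {b N : ℕ}
    (hN : l.length ≤ N) (h : ∀ v ∈ l, (f v).depth ≤ b) :
    (store l f old).depth ≤ 2 + Nat.clog 2 N + b := by
  have h1 := Nat.clog_mono_right 2 hN
  have h2 := foldr_max_le h
  simp only [store]; omega

end store

@[simp] lemma parFilter_val (p : α → Comp ω Bool) (l : List α) :
    (parFilter p l).val = l.filter fun a => (p a).val := by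
  simp only [parFilter, pack, bind_val, parMap_val, instr_val]
  induction l with
  | nil => rfl
  | cons a l ih => by_cases h : (p a).val <;> simp_all

lemma parFilter_out {p : α → Comp ω Bool} {l : List α} (h : ∀ a ∈ l, (p a).out = 0) :
    (parFilter p l).out = 0 := by
  simp only [parFilter, pack, bind_out, parMap_out, instr_out, add_zero]
  exact sum_map_eq_zero h

lemma parFilter_work (p : α → Comp ω Bool) (l : List α) :
    (parFilter p l).work = 2 + 3 * l.length + (l.map fun a => (p a).work).sum := by
  simp only [parFilter, pack, bind_work, parMap_work, parMap_val, instr_work, List.length_map]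
  have := sum_map_const_add l (fun a => (p a).work) 1
  simp only [add_comm 1] at this
  omega

lemma parFilter_work_le {p : α → Comp ω Bool} {l : List α} {b : ℕ}
    (h : ∀ a ∈ l, (p a).work ≤ b) : (parFilter p l).work ≤ 2 + l.length * (3 + b) := by
  have := sum_map_le_mul h
  rw [parFilter_work]; linarith

lemma parFilter_depth_le {p : α → Comp ω Bool} {l : List α} {b N : ℕ} (hN : l.length ≤ N)
    (h : ∀ a ∈ l, (p a).depth ≤ b) : (parFilter p l).depth ≤ 3 + 2 * Nat.clog 2 N + b := by
  have h1 : (parMap (fun a => do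
    let b ← p a
    instr (a, b)) l : Comp ω _).depth ≤ 1 + Nat.clog 2 N + (b + 1) :=
    parMap_depth_le hN fun a ha => by simpa using h a ha
  have h2 := Nat.clog_mono_right 2 hN
  simp only [parFilter, bind_depth]
  simp only [pack, parMap_val, List.length_map]
  omega

lemma parCount_val (p : α → Comp ω Bool) (l : List α) :
    (parCount p l).val = (l.filter fun a => (p a).val).length := by
  simp only [parCount, bind_val, parMap_val, instr_val, reduce_val]
  induction l with
  | nil => rfl
  | cons a l ih => by_cases h : (p a).val <;> simp_all [add_comm]

lemma parCount_out {p : α → Comp ω Bool} {l : List α} (h : ∀ a ∈ l, (p a).out = 0) :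
    (parCount p l).out = 0 := by
  simp only [parCount, bind_out, parMap_out, instr_out, add_zero, reduce_out]
  exact sum_map_eq_zero h

lemma parCount_work_le {p : α → Comp ω Bool} {l : List α} {b : ℕ}
    (h : ∀ a ∈ l, (p a).work ≤ b) : (parCount p l).work ≤ 2 + l.length * (3 + b) := by
  have h1 : (parMap (fun a => do
    let b ← p a
    instr (if b then 1 else 0)) l : Comp ω (List ℕ)).work ≤ 1 + l.length * (1 + (b + 1)) :=
    parMap_work_le fun a ha => by simpa using h a ha
  simp only [parCount, bind_work, reduce_work, parMap_val, List.length_map]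
  linarith

lemma parCount_depth_le {p : α → Comp ω Bool} {l : List α} {b N : ℕ} (hN : l.length ≤ N)
    (h : ∀ a ∈ l, (p a).depth ≤ b) : (parCount p l).depth ≤ 3 + 2 * Nat.clog 2 N + b := by
  have h1 : (parMap (fun a => do
    let b ← p a
    instr (if b then 1 else 0)) l : Comp ω (List ℕ)).depth ≤ 1 + Nat.clog 2 N + (b + 1) :=
    parMap_depth_le hN fun a ha => by simpa using h a ha
  have h2 := Nat.clog_mono_right 2 hN
  simp only [parCount, bind_depth]
  simp only [reduce, parMap_val, List.length_map]
  omega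

section parMem

variable [DecidableEq α]

@[simp] lemma parMem_val (a : α) (l : List α) :
    (parMem a l : Comp ω Bool).val = decide (a ∈ l) := by
  simp only [parMem, bind_val, parMap_val, instr_val, reduce_val]
  induction l with
  | nil => rfl
  | cons b l ih => by_cases h : b = a <;> simp_all [eq_comm]

@[simp] lemma parMem_out (a : α) (l : List α) : (parMem a l : Comp ω Bool).out = 0 := by
  simp [parMem]

@[simp] lemma parMem_work (a : α) (l : List α) :
    (parMem a l : Comp ω Bool).work = 2 + 3 * l.length := by
  simp only [parMem, bind_work, parMap_work, parMap_val, reduce_work, instr_work,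
    List.length_map, List.map_const', List.sum_replicate]
  simp; ring

lemma parMem_depth_le (a : α) {l : List α} {N : ℕ} (hN : l.length ≤ N) :
    (parMem a l : Comp ω Bool).depth ≤ 3 + 2 * Nat.clog 2 N := by
  have h1 : (parMap (fun b => instr (decide (b = a))) l : Comp ω _).depth
    ≤ 1 + Nat.clog 2 N + 1 := parMap_depth_le hN fun a ha => by simp
  have h2 := Nat.clog_mono_right 2 hN
  simp only [parMem, bind_depth]
  simp only [reduce, parMap_val, List.length_map]
  omega

end parMem

end Comp

/-! ### One level of the recursion of `BK-Pivot` -/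

section Level

open Comp

variable {n : ℕ}

/-- The vertices of `P` that are not neighbours of the pivot `u`. -/
def branching (P : List (Cand n)) (u : Cand n) : List (Cand n) :=
  P.filter fun w => !decide (w.vtx ∈ u.nbr)

/-- The vertices of `P` that are neighbours of the pivot `u`. -/
def common (P : List (Cand n)) (u : Cand n) : List (Cand n) :=
  P.filter fun w => decide (w.vtx ∈ u.nbr)

/-- The set `P` of the recursive call for `v` when the pivot is `u`. -/
def childP (P : List (Cand n)) (u v : Cand n) : List (Cand n) :=
  (common P u ++ (branching P u).filter fun w => decide (v.vtx < w.vtx)).filter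
    fun w => decide (v.vtx ∈ w.nbr)

/-- The set `X` of the recursive call for `v` when the pivot is `u`. -/
def childX (P X : List (Cand n)) (u v : Cand n) : List (Cand n) :=
  (X ++ (branching P u).filter fun w => decide (w.vtx < v.vtx)).filter
    fun w => decide (v.vtx ∈ w.nbr)

lemma length_branching_add_common (P : List (Cand n)) (u : Cand n) :
    (branching P u).length + (common P u).length = P.length := by
  induction P with
  | nil => rfl
  | cons a P ih => by_cases h : a.vtx ∈ u.nbr <;> simp_all [branching, common] <;> omega

lemma foldr_argmax {α : Type*} (e : α × ℕ) (l : List (α × ℕ)) :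
    let r := l.foldr (fun a b => if a.2 < b.2 then b else a) e
    (r = e ∨ r ∈ l) ∧ ∀ a ∈ l, a.2 ≤ r.2 := by
  induction l with
  | nil => simp
  | cons a l ih =>
    simp only [List.foldr_cons, List.mem_cons, forall_eq_or_imp] at ih ⊢
    obtain ⟨h1, h2⟩ := ih
    split_ifs with h
    · exact ⟨by tauto, h.le, h2⟩
    · exact ⟨by tauto, le_rfl, fun b hb => (h2 b hb).trans (not_lt.1 h)⟩

lemma bkPivot_nil_out (fuel : ℕ) (R : List (Fin n)) :
    (bkPivot (fuel + 1) [] R []).out = {R.toFinset} := by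
  simp [bkPivot, emit]

lemma bkPivot_nil_work (fuel : ℕ) (R : List (Fin n)) :
    (bkPivot (fuel + 1) [] R []).work = 3 + R.length := by
  simp [bkPivot, emit]; ring

lemma bkPivot_nil_depth (fuel : ℕ) (R : List (Fin n)) :
    (bkPivot (fuel + 1) [] R []).depth = 3 + R.length := by
  simp [bkPivot, emit, concat]; ring

/-- The recursive call of `BK-Pivot` for the vertex `v`, together with its preparation. -/
def branchCall (fuel : ℕ) (P : List (Cand n)) (R : List (Fin n)) (X : List (Cand n))
    (u v : Cand n) : Comp (Finset (Fin n)) Unit := do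
  let later ← parFilter (fun w => instr (decide (v.vtx < w.vtx))) (branching P u)
  let earlier ← parFilter (fun w => instr (decide (w.vtx < v.vtx))) (branching P u)
  let Pv ← concat (common P u) later
  let Xv ← concat X earlier
  let Pnew ← parFilter (fun w => parMem v.vtx w.nbr) Pv
  let Xnew ← parFilter (fun w => parMem v.vtx w.nbr) Xv
  let Rnew ← instr (v.vtx :: R)
  bkPivot fuel Pnew Rnew Xnew

/-- The part of one level of `BK-Pivot` that precedes the recursive calls. It delivers the
pivot. -/
def choosePivot (P X : List (Cand n)) (s : Cand n) : Comp (Finset (Fin n)) (Cand n) := do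
  let scored ← parMap (fun u => do
    let k ← parCount (fun w => parMem w.vtx u.nbr) P
    instr (u, k)) (P ++ X)
  let best ← reduce (fun a b => if a.2 < b.2 then b else a) (s, 0) scored
  instr best.1

lemma bkPivot_succ {P X : List (Cand n)} {s : Cand n} (h : (P ++ X).head? = some s) (fuel : ℕ)
    (R : List (Fin n)) : bkPivot (fuel + 1) P R X = (do
      let _ ← concat P X
      let _ ← instr (P ++ X).head?
      let u ← choosePivot P X s
      let Q ← parFilter (fun w => do
        let b ← parMem w.vtx u.nbr
        instr (!b)) P
      let _ ← parFilter (fun w => parMem w.vtx u.nbr) P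
      let _ ← parMap (branchCall fuel P R X u) Q
      pure ()) := by
  have ext : ∀ {x y : Comp (Finset (Fin n)) Unit}, x.work = y.work → x.depth = y.depth →
      x.out = y.out → x = y := by
    rintro ⟨⟩ ⟨⟩ rfl rfl rfl
    rfl
  apply ext
  · simp only [bkPivot, h, choosePivot, bind_work, bind_val, instr_val, parFilter_val, concat_val,
      parMem_val, add_assoc]
    rfl
  · simp only [bkPivot, h, choosePivot, bind_depth, bind_val, instr_val, parFilter_val, concat_val,
      parMem_val, add_assoc]
    rfl
  · simp only [bkPivot, h, choosePivot, bind_out, bind_val, instr_val, parFilter_val, concat_val,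
      parMem_val, add_assoc]
    rfl

lemma choosePivot_val {P X : List (Cand n)} {s : Cand n} (hs : s ∈ P ++ X) :
    (choosePivot P X s).val ∈ P ++ X ∧ ∀ u ∈ P ++ X,
      (common P u).length ≤ (common P (choosePivot P X s).val).length := by
  have h := foldr_argmax (s, 0) ((P ++ X).map fun u => (u, (common P u).length))
  have e : (choosePivot P X s).val =
      (((P ++ X).map fun u => (u, (common P u).length)).foldr
        (fun a b => if a.2 < b.2 then b else a) (s, 0)).1 := by
    simp only [choosePivot, bind_val, parMap_val, instr_val, reduce_val, parCount_val, parMem_val]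
    rfl
  rw [e]
  set r := ((P ++ X).map fun u => (u, (common P u).length)).foldr
        (fun a b => if a.2 < b.2 then b else a) (s, 0)
  obtain ⟨h1, h2⟩ := h
  have h3 : r.1 ∈ P ++ X ∧ r.2 ≤ (common P r.1).length := by
    rcases h1 with h1 | h1
    · rw [h1]; exact ⟨hs, Nat.zero_le _⟩
    · obtain ⟨u, hu, h1⟩ := List.mem_map.1 h1
      rw [← h1]; exact ⟨hu, le_rfl⟩
  exact ⟨h3.1, fun u hu => (h2 _ (List.mem_map_of_mem hu)).trans h3.2⟩

lemma choosePivot_out (P X : List (Cand n)) (s : Cand n) : (choosePivot P X s).out = 0 := by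
  simp only [choosePivot, bind_out, parMap_out, reduce_out, instr_out, add_zero]
  exact sum_map_eq_zero fun u _ => parCount_out fun w _ => parMem_out _ _

lemma choosePivot_work_le {P X : List (Cand n)} {D : ℕ} (hD : ∀ c ∈ P ++ X, c.nbr.length ≤ D)
    (s : Cand n) :
    (choosePivot P X s).work ≤
      3 + (P.length + X.length) * (5 + P.length * (5 + 3 * D)) := by
  have h : (parMap (fun u => do
      let k ← parCount (fun w => parMem w.vtx u.nbr) P
      instr (u, k)) (P ++ X) : Comp (Finset (Fin n)) _).work ≤
        1 + (P ++ X).length * (1 + (2 + P.length * (3 + (2 + 3 * D)) + 1)) := by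
    refine parMap_work_le fun u hu => ?_
    have := hD u hu
    simp only [bind_work, instr_work]
    refine Nat.add_le_add_right (parCount_work_le fun w _ => ?_) 1
    rw [parMem_work]; omega
  simp only [choosePivot, bind_work, reduce_work, instr_work, parMap_val, List.length_map,
    List.length_append] at h ⊢
  linarith

lemma choosePivot_depth_le {P X : List (Cand n)} {N : ℕ} (hN : P.length + X.length ≤ N)
    (hD : ∀ c ∈ P ++ X, c.nbr.length ≤ N) (s : Cand n) :
    (choosePivot P X s).depth ≤ 10 + 6 * Nat.clog 2 N := by
  have h : (parMap (fun u => do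
      let k ← parCount (fun w => parMem w.vtx u.nbr) P
      instr (u, k)) (P ++ X) : Comp (Finset (Fin n)) _).depth ≤
        1 + Nat.clog 2 N + ((3 + 2 * Nat.clog 2 N + (3 + 2 * Nat.clog 2 N)) + 1) := by
    refine parMap_depth_le (by simpa using hN) fun u hu => ?_
    simp only [bind_depth, instr_depth]
    exact Nat.add_le_add_right (parCount_depth_le (by omega) fun w _ =>
      parMem_depth_le _ (hD u hu)) 1
  simp only [choosePivot, bind_depth, instr_depth]
  have h2 := reduce_depth_le (ω := Finset (Fin n))
    (fun a b : Cand n × ℕ => if a.2 < b.2 then b else a) (s, 0) (N := N)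
    (l := (parMap (fun u => do
      let k ← parCount (fun w => parMem w.vtx u.nbr) P
      instr (u, k)) (P ++ X) : Comp (Finset (Fin n)) _).val) (by simpa using hN)
  omega

lemma branchCall_out (fuel : ℕ) (P : List (Cand n)) (R : List (Fin n)) (X : List (Cand n))
    (u v : Cand n) : (branchCall fuel P R X u v).out =
      (bkPivot fuel (childP P u v) (v.vtx :: R) (childX P X u v)).out := by
  simp only [branchCall, bind_out, instr_val, instr_out, concat_val, concat_out,
    parFilter_val, parMem_val]
  repeat rw [parFilter_out (by simp)]
  simp only [zero_add]
  rfl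

lemma length_later_le (P : List (Cand n)) (u : Cand n) (p : Cand n → Bool) :
    (common P u).length + ((branching P u).filter p).length ≤ P.length := by
  have h1 := length_branching_add_common P u
  have h2 := List.length_filter_le p (branching P u)
  omega

lemma length_earlier_le (P : List (Cand n)) (u : Cand n) (p : Cand n → Bool) :
    ((branching P u).filter p).length ≤ P.length := by
  have := length_later_le P u p
  omega

lemma branchCall_work_le {P X : List (Cand n)} {D : ℕ} (hD : ∀ c ∈ P ++ X, c.nbr.length ≤ D)
    (fuel : ℕ) (R : List (Fin n)) (u v : Cand n) : (branchCall fuel P R X u v).work ≤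
      11 + (P.length + X.length) * (20 + 6 * D) +
      (bkPivot fuel (childP P u v) (v.vtx :: R) (childX P X u v)).work := by
  have h1 := length_branching_add_common P u
  have h2 := length_later_le P u fun w => decide (v.vtx < w.vtx)
  have h3 := length_earlier_le P u fun w => decide (w.vtx < v.vtx)
  have hmem : ∀ w, (w ∈ branching P u ∨ w ∈ common P u) ∨ w ∈ X → w ∈ P ++ X := by
    simp only [branching, common, List.mem_filter, List.mem_append]; tauto
  have h4 : ∀ l : List (Cand n), (∀ w ∈ l, w ∈ P ++ X) →
      (parFilter (fun w => parMem v.vtx w.nbr) l : Comp (Finset (Fin n)) _).work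
        ≤ 2 + l.length * (3 + (2 + 3 * D)) := fun l hl => parFilter_work_le fun w hw => by
    rw [parMem_work]; have := hD w (hl w hw); omega
  have h5 := h4 (common P u ++ (branching P u).filter fun w => decide (v.vtx < w.vtx))
    (by intro w hw; apply hmem; simp at hw; tauto)
  have h6 := h4 (X ++ (branching P u).filter fun w => decide (w.vtx < v.vtx))
    (by intro w hw; apply hmem; simp at hw; tauto)
  have h7 : ∀ p : Cand n → Bool,
      (parFilter (fun w => instr (p w)) (branching P u) : Comp (Finset (Fin n)) _).work
        ≤ 2 + (branching P u).length * (3 + 1) := fun p => parFilter_work_le fun w _ => by simp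
  have h8 := h7 fun w => decide (v.vtx < w.vtx)
  have h9 := h7 fun w => decide (w.vtx < v.vtx)
  simp only [branchCall, bind_work, instr_val, instr_work, concat_val, concat_work,
    parFilter_val, parMem_val]
  change _ + (_ + (_ + (_ + (_ + (_ + (_ +
    (bkPivot fuel (childP P u v) (v.vtx :: R) (childX P X u v)).work)))))) ≤ _
  rw [List.length_append] at h5 h6
  have h10 := Nat.mul_le_mul_right (3 + (2 + 3 * D)) h2
  have h11 := Nat.mul_le_mul_right (3 + (2 + 3 * D)) (Nat.add_le_add_left h3 X.length)
  have h12 : (branching P u).length ≤ P.length := List.length_filter_le _ _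
  linarith [Nat.zero_le (X.length * D)]

lemma branchCall_depth_le {P X : List (Cand n)} {N : ℕ} (hN : P.length + X.length ≤ N)
    (hD : ∀ c ∈ P ++ X, c.nbr.length ≤ N) (fuel : ℕ) (R : List (Fin n)) (u v : Cand n) :
    (branchCall fuel P R X u v).depth ≤ 23 + 14 * Nat.clog 2 N +
      (bkPivot fuel (childP P u v) (v.vtx :: R) (childX P X u v)).depth := by
  have h1 := length_branching_add_common P u
  have h2 := length_later_le P u fun w => decide (v.vtx < w.vtx)
  have h3 := length_earlier_le P u fun w => decide (w.vtx < v.vtx)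
  have hmem : ∀ w, (w ∈ branching P u ∨ w ∈ common P u) ∨ w ∈ X → w ∈ P ++ X := by
    simp only [branching, common, List.mem_filter, List.mem_append]; tauto
  have h4 : ∀ l : List (Cand n), l.length ≤ N → (∀ w ∈ l, w ∈ P ++ X) →
      (parFilter (fun w => parMem v.vtx w.nbr) l : Comp (Finset (Fin n)) _).depth
        ≤ 3 + 2 * Nat.clog 2 N + (3 + 2 * Nat.clog 2 N) := fun l hl' hl =>
    parFilter_depth_le hl' fun w hw => parMem_depth_le _ (hD w (hl w hw))
  have h5 := h4 (common P u ++ (branching P u).filter fun w => decide (v.vtx < w.vtx))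
    (by rw [List.length_append]; omega) (by intro w hw; apply hmem; simp at hw; tauto)
  have h6 := h4 (X ++ (branching P u).filter fun w => decide (w.vtx < v.vtx))
    (by rw [List.length_append]; omega) (by intro w hw; apply hmem; simp at hw; tauto)
  have h7 : ∀ p : Cand n → Bool,
      (parFilter (fun w => instr (p w)) (branching P u) : Comp (Finset (Fin n)) _).depth
        ≤ 3 + 2 * Nat.clog 2 N + 1 := fun p => parFilter_depth_le (by omega) fun w _ => by simp
  have h8 := h7 fun w => decide (v.vtx < w.vtx)
  have h9 := h7 fun w => decide (w.vtx < v.vtx)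
  have h10 := concat_depth_le (ω := Finset (Fin n)) (N := N) (l₁ := common P u)
    (l₂ := (branching P u).filter fun w => decide (v.vtx < w.vtx)) (by omega)
  have h11 := concat_depth_le (ω := Finset (Fin n)) (N := N) (l₁ := X)
    (l₂ := (branching P u).filter fun w => decide (w.vtx < v.vtx)) (by omega)
  simp only [branchCall, bind_depth, instr_val, instr_depth, concat_val,
    parFilter_val, parMem_val]
  change _ + (_ + (_ + (_ + (_ + (_ + (_ +
    (bkPivot fuel (childP P u v) (v.vtx :: R) (childX P X u v)).depth)))))) ≤ _
  omega

/-- One level of the recursion of `BK-Pivot` on a nonempty set `P ∪ X`: the choice of the pivot,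
the output, and the costs. -/
lemma bkPivot_level {P X : List (Cand n)} (h : P ++ X ≠ []) (fuel : ℕ) (R : List (Fin n)) :
    ∃ u ∈ P ++ X, (∀ u' ∈ P ++ X, (common P u').length ≤ (common P u).length) ∧
      (bkPivot (fuel + 1) P R X).out = ((branching P u).map fun v =>
        (bkPivot fuel (childP P u v) (v.vtx :: R) (childX P X u v)).out).sum ∧
      (∀ D, (∀ c ∈ P ++ X, c.nbr.length ≤ D) → (bkPivot (fuel + 1) P R X).work ≤
        100 * ((P.length + X.length + 1) * (D + 1)) * (P.length + 1) +
        ((branching P u).map fun v =>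
          (bkPivot fuel (childP P u v) (v.vtx :: R) (childX P X u v)).work).sum) ∧
      (∀ N b, P.length + X.length ≤ N → (∀ c ∈ P ++ X, c.nbr.length ≤ N) →
        (∀ v ∈ branching P u,
          (bkPivot fuel (childP P u v) (v.vtx :: R) (childX P X u v)).depth ≤ b) →
        (bkPivot (fuel + 1) P R X).depth ≤ 100 * (Nat.clog 2 N + 1) + b) := by
  obtain ⟨s, l, hs⟩ := List.exists_cons_of_ne_nil h
  have hs' : (P ++ X).head? = some s := by rw [hs]; rfl
  have hsm : s ∈ P ++ X := by rw [hs]; simp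
  obtain ⟨hu, hmax⟩ := choosePivot_val hsm
  refine ⟨_, hu, hmax, ?_, fun D hD => ?_, fun N b hN hD hb => ?_⟩
  · simp only [bkPivot_succ hs', bind_out, bind_val, choosePivot_out, concat_out, instr_out,
      parMap_out, parFilter_val, parMem_val, branchCall_out, pure_out, instr_val]
    rw [parFilter_out (by simp), parFilter_out (by simp)]
    simp only [zero_add, add_zero]
    rfl
  · simp only [bkPivot_succ hs', bind_work, bind_val, concat_work, instr_work, instr_val,
      parFilter_val, parMem_val, pure_work]
    set u := (choosePivot P X s).val
    have h1 := choosePivot_work_le hD s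
    have hDu := hD u hu
    have h2 : (parFilter (fun w => do
        let b ← parMem w.vtx u.nbr
        instr (!b)) P : Comp (Finset (Fin n)) _).work ≤ 2 + P.length * (3 + (3 + 3 * D)) :=
      parFilter_work_le fun w _ => by simp only [bind_work, parMem_work, instr_work]; omega
    have h3 : (parFilter (fun w => parMem w.vtx u.nbr) P : Comp (Finset (Fin n)) _).work ≤
        2 + P.length * (3 + (2 + 3 * D)) :=
      parFilter_work_le fun w _ => by simp only [parMem_work]; omega
    change _ + (_ + (_ + (_ + (_ + ((parMap (branchCall fuel P R X u) (branching P u)).work +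
      0))))) ≤ _
    have h4 : ((branching P u).map fun v => (branchCall fuel P R X u v).work).sum ≤
        (branching P u).length * (11 + (P.length + X.length) * (20 + 6 * D)) +
        ((branching P u).map fun v =>
          (bkPivot fuel (childP P u v) (v.vtx :: R) (childX P X u v)).work).sum := by
      rw [mul_comm, ← sum_map_const_add]
      exact List.sum_le_sum fun v _ => branchCall_work_le hD fuel R u v
    rw [parMap_work]
    have h5 : (branching P u).length ≤ P.length := List.length_filter_le _ _
    have h6 := Nat.mul_le_mul_right (11 + (P.length + X.length) * (20 + 6 * D)) h5
    generalize P.length = p at *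
    generalize X.length = x at *
    nlinarith [Nat.zero_le (p * p * D), Nat.zero_le (p * x * D), Nat.zero_le (p * p),
      Nat.zero_le (p * x), Nat.zero_le (x * D), Nat.zero_le (p * D), Nat.zero_le D]
  · simp only [bkPivot_succ hs', bind_depth, bind_val, instr_depth, instr_val,
      parFilter_val, parMem_val, pure_depth]
    set u := (choosePivot P X s).val
    have h1 := choosePivot_depth_le hN hD s
    have h2 : (parFilter (fun w => do
        let b ← parMem w.vtx u.nbr
        instr (!b)) P : Comp (Finset (Fin n)) _).depth ≤
          3 + 2 * Nat.clog 2 N + (3 + 2 * Nat.clog 2 N + 1) :=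
      parFilter_depth_le (by omega) fun w _ => by
        simp only [bind_depth, instr_depth]
        exact Nat.add_le_add_right (parMem_depth_le _ (hD u hu)) 1
    have h3 : (parFilter (fun w => parMem w.vtx u.nbr) P : Comp (Finset (Fin n)) _).depth ≤
        3 + 2 * Nat.clog 2 N + (3 + 2 * Nat.clog 2 N) :=
      parFilter_depth_le (by omega) fun w _ => parMem_depth_le _ (hD u hu)
    change _ + (_ + (_ + (_ + (_ + ((parMap (branchCall fuel P R X u) (branching P u)).depth +
      0))))) ≤ _
    have h4 : (branching P u).length ≤ P.length := List.length_filter_le _ _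
    have h5 : (parMap (branchCall fuel P R X u) (branching P u)).depth ≤
        1 + Nat.clog 2 N + (23 + 14 * Nat.clog 2 N + b) :=
      parMap_depth_le (by omega) fun v hv =>
        (branchCall_depth_le hN hD fuel R u v).trans (Nat.add_le_add_left (hb v hv) _)
    have h6 := concat_depth_le (ω := Finset (Fin n)) hN
    omega

end Level

/-! ### Maximal cliques inside a pair of sets -/

section RestrictedCliques

variable {V : Type*} [DecidableEq V]

open Classical in
/-- The cliques contained in `P` that no vertex of `P ∪ X` extends. -/
noncomputable def restrictedCliques (G : SimpleGraph V) (P X : Finset V) : Finset (Finset V) :=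
  P.powerset.filter fun K => G.IsClique (K : Set V) ∧ ∀ y ∈ P ∪ X, y ∉ K → ∃ z ∈ K, ¬ G.Adj y z

lemma mem_restrictedCliques {G : SimpleGraph V} {P X K : Finset V} :
    K ∈ restrictedCliques G P X ↔ K ⊆ P ∧ G.IsClique (K : Set V) ∧
      ∀ y ∈ P ∪ X, y ∉ K → ∃ z ∈ K, ¬ G.Adj y z := by
  simp [restrictedCliques]

lemma restrictedCliques_empty (G : SimpleGraph V) : restrictedCliques G ∅ ∅ = {∅} := by
  ext K
  simp only [mem_restrictedCliques, Finset.mem_singleton, Finset.subset_empty]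
  constructor
  · exact fun h => h.1
  · rintro rfl; simp

lemma exists_mem_not_adj_pivot {G : SimpleGraph V} {P X K : Finset V}
    (hK : K ∈ restrictedCliques G P X) {u : V} (hu : u ∈ P ∪ X) :
    ∃ v ∈ K, ¬ G.Adj u v := by
  obtain ⟨-, -, h⟩ := mem_restrictedCliques.1 hK
  by_cases huK : u ∈ K
  · exact ⟨u, huK, G.loopless.irrefl u⟩
  · exact h u hu huK

open Classical in
/-- The cliques are partitioned by their first vertex in `Q`, where the vertices are ordered
by `f`. -/
lemma sum_restrictedCliques {M κ : Type*} [AddCommMonoid M] [LinearOrder κ] (G : SimpleGraph V)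
    {P X Q : Finset V} (hQP : Q ⊆ P) {f : V → κ} (hf : Function.Injective f)
    (hQ : ∀ K ∈ restrictedCliques G P X, ∃ v ∈ Q, v ∈ K) (F : Finset V → M) :
    ∑ K ∈ restrictedCliques G P X, F K = ∑ v ∈ Q,
      ∑ K ∈ restrictedCliques G (P.filter fun w => G.Adj v w ∧ (w ∈ Q → f v < f w))
        ((P ∪ X).filter fun w => G.Adj v w ∧ (w ∈ X ∨ (w ∈ Q ∧ f w < f v))), F (insert v K) := by
  rw [Finset.sum_sigma']
  symm
  have first : ∀ v K, K ⊆ P.filter (fun w => G.Adj v w ∧ (w ∈ Q → f v < f w)) →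
      v ∉ K ∧ ∀ w ∈ K, w ∈ Q → f v < f w := by
    intro v K h
    refine ⟨fun hv => ?_, fun w hw => (Finset.mem_filter.1 (h hw)).2.2⟩
    exact G.loopless.irrefl v (Finset.mem_filter.1 (h hv)).2.1
  refine Finset.sum_bij (fun p _ => insert p.1 p.2) ?_ ?_ ?_ fun _ _ => rfl
  · rintro ⟨v, K⟩ h
    simp only [Finset.mem_sigma, mem_restrictedCliques] at h ⊢
    obtain ⟨hv, h1, h2, h3⟩ := h
    refine ⟨Finset.insert_subset (hQP hv) (h1.trans (Finset.filter_subset _ _)), ?_, ?_⟩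
    · rw [Finset.coe_insert, SimpleGraph.isClique_insert]
      exact ⟨h2, fun w hw _ => (Finset.mem_filter.1 (h1 hw)).2.1⟩
    · intro y hy hyK
      rw [Finset.mem_insert, not_or] at hyK
      by_cases hvy : G.Adj v y
      · obtain ⟨z, hz, h4⟩ := h3 y (by
          simp only [Finset.mem_union, Finset.mem_filter] at hy ⊢
          rcases lt_trichotomy (f v) (f y) with h | h | h
          · tauto
          · exact absurd (hf h).symm hyK.1
          · tauto) hyK.2
        exact ⟨z, by simp [hz], h4⟩
      · exact ⟨v, by simp, fun h => hvy h.symm⟩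
  · rintro ⟨v, K⟩ h ⟨v', K'⟩ h' e
    simp only [Finset.mem_sigma, mem_restrictedCliques] at h h' e
    obtain ⟨hK1, hK2⟩ := first v K h.2.1
    obtain ⟨hK1', hK2'⟩ := first v' K' h'.2.1
    have hvv : v = v' := by
      by_contra hne
      have h1 : v ∈ insert v' K' := e ▸ Finset.mem_insert_self _ _
      have h2 : v' ∈ insert v K := e ▸ Finset.mem_insert_self _ _
      rw [Finset.mem_insert] at h1 h2
      have h3 := hK2' v (h1.resolve_left hne) h.1
      have h4 := hK2 v' (h2.resolve_left (Ne.symm hne)) h'.1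
      exact lt_asymm h3 h4
    subst hvv
    have : K = K' := by rw [← Finset.erase_insert hK1, e, Finset.erase_insert hK1']
    rw [this]
  · intro K hK
    obtain ⟨v₀, hv₀, hv₀K⟩ := hQ K hK
    obtain ⟨v, hv, hmin⟩ := Finset.exists_min_image (Q ∩ K) f ⟨v₀, by simp [hv₀, hv₀K]⟩
    rw [Finset.mem_inter] at hv
    obtain ⟨h1, h2, h3⟩ := mem_restrictedCliques.1 hK
    refine ⟨⟨v, K.erase v⟩, ?_, Finset.insert_erase hv.2⟩
    simp only [Finset.mem_sigma, mem_restrictedCliques]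
    refine ⟨hv.1, ?_, h2.subset (by simp), ?_⟩
    · intro w hw
      rw [Finset.mem_erase] at hw
      refine Finset.mem_filter.2 ⟨h1 hw.2, h2 hv.2 hw.2 hw.1.symm, fun hwQ => ?_⟩
      exact lt_of_le_of_ne (hmin w (Finset.mem_inter.2 ⟨hwQ, hw.2⟩)) fun h => hw.1 (hf h).symm
    · intro y hy hyK
      have hvy : G.Adj v y := by
        simp only [Finset.mem_union, Finset.mem_filter] at hy; tauto
      obtain ⟨z, hz, h4⟩ := h3 y (by
        simp only [Finset.mem_union, Finset.mem_filter] at hy ⊢; tauto)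
        fun h => hyK (Finset.mem_erase.2 ⟨hvy.ne', h⟩)
      exact ⟨z, Finset.mem_erase.2 ⟨fun h => h4 (h ▸ hvy.symm), hz⟩, h4⟩

lemma restrictedCliques_univ [Fintype V] (G : SimpleGraph V) :
    restrictedCliques G Finset.univ ∅ = maximalCliques G := by
  ext K
  simp only [mem_restrictedCliques, maximalCliques, Finset.mem_filter, Finset.mem_univ, true_and,
    Finset.subset_univ, Finset.union_empty, true_imp_iff]
  constructor
  · rintro ⟨h1, h2⟩
    refine ⟨h1, fun L hL hKL y hy => ?_⟩
    by_contra hyK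
    obtain ⟨z, hz, h⟩ := h2 y hyK
    exact h (hL hy (hKL hz) fun e => hyK (e ▸ hz))
  · rintro ⟨h1, h2⟩
    refine ⟨h1, fun y hy => ?_⟩
    by_contra! h
    refine hy (h2 (y := insert y K) ?_ (Finset.subset_insert _ _) (Finset.mem_insert_self _ _))
    simp only [Finset.coe_insert, SimpleGraph.isClique_insert]
    exact ⟨h1, fun z hz _ => h z hz⟩

end RestrictedCliques

/-! ### The invariant and the output of `BK-Pivot` -/

section Output

open Comp

variable {n : ℕ}

/-- The arrays `P` and `X` have no repetitions, `P` is contained in the outermost set `P₀`, and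
the arrays of neighbours tell which vertices of `P₀` are adjacent in `G`. -/
structure CandInv (G : SimpleGraph (Fin n)) (P₀ : Finset (Fin n)) (P X : List (Cand n)) :
    Prop where
  nodup : (P ++ X).Nodup
  inj : ∀ c ∈ P ++ X, ∀ c' ∈ P ++ X, c.vtx = c'.vtx → c = c'
  sub : ∀ c ∈ P, c.vtx ∈ P₀
  adj : ∀ c ∈ P ++ X, ∀ p ∈ P₀, p ∈ c.nbr ↔ G.Adj c.vtx p

lemma childP_append_childX_subset (P X : List (Cand n)) (u v : Cand n) :
    childP P u v ++ childX P X u v ⊆ P ++ X := by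
  intro w
  simp only [childP, childX, branching, common, List.mem_append, List.mem_filter]
  tauto

lemma childP_subset (P : List (Cand n)) (u v : Cand n) : childP P u v ⊆ P := by
  intro w
  simp only [childP, branching, common, List.mem_append, List.mem_filter]
  tauto

namespace CandInv

variable {G : SimpleGraph (Fin n)} {P₀ : Finset (Fin n)} {P X : List (Cand n)}

lemma child (h : CandInv G P₀ P X) (u v : Cand n) :
    CandInv G P₀ (childP P u v) (childX P X u v) where
  nodup := by
    have h1 := h.nodup
    rw [List.nodup_append'] at h1
    obtain ⟨hP, hX, hPX⟩ := h1
    rw [List.nodup_append']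
    refine ⟨List.Nodup.filter _ ?_, List.Nodup.filter _ ?_, ?_⟩
    · rw [List.nodup_append']
      refine ⟨hP.filter _, (hP.filter _).filter _, fun w hw hw' => ?_⟩
      simp [common, branching] at hw hw'
      tauto
    · rw [List.nodup_append']
      refine ⟨hX, (hP.filter _).filter _, fun w hw hw' => hPX ?_ hw⟩
      simp [branching] at hw'
      exact hw'.1
    · intro w hw hw'
      simp [childP, childX, common, branching] at hw hw'
      have := @hPX w
      have := @lt_asymm _ _ w.vtx v.vtx
      tauto
  inj c hc c' hc' := h.inj c (childP_append_childX_subset P X u v hc) c'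
    (childP_append_childX_subset P X u v hc')
  sub c hc := h.sub c (childP_subset P u v hc)
  adj c hc := h.adj c (childP_append_childX_subset P X u v hc)

lemma length_child_le (h : CandInv G P₀ P X) (u v : Cand n) :
    (childP P u v).length + (childX P X u v).length ≤ P.length + X.length := by
  rw [← List.length_append, ← List.length_append]
  exact (List.subperm_of_subset (h.child u v).nodup
    (childP_append_childX_subset P X u v)).length_le

lemma length_branching_add_childP_le (h : CandInv G P₀ P X) {u v : Cand n}
    (hu : ∀ u' ∈ P ++ X, (common P u').length ≤ (common P u).length) (hv : v ∈ branching P u) :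
    (branching P u).length + (childP P u v).length ≤ P.length := by
  have hvP : v ∈ P := List.mem_of_mem_filter hv
  have h1 : (childP P u v).length ≤ (common P v).length := by
    refine (List.subperm_of_subset (List.nodup_append'.1 (h.child u v).nodup).1 ?_).length_le
    intro w hw
    have hwP := childP_subset P u v hw
    refine List.mem_filter.2 ⟨hwP, decide_eq_true ?_⟩
    have h2 : v.vtx ∈ w.nbr := of_decide_eq_true (List.mem_filter.1 hw).2
    rw [h.adj w (by simp [hwP]) _ (h.sub v hvP)] at h2
    rw [h.adj v (by simp [hvP]) _ (h.sub w hwP)]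
    exact h2.symm
  have h2 := hu v (by simp [hvP])
  have h3 := length_branching_add_common P u
  omega

end CandInv

/-- The set of the vertices in an array. -/
def vset (P : List (Cand n)) : Finset (Fin n) := (P.map Cand.vtx).toFinset

lemma mem_vset {P : List (Cand n)} {x : Fin n} : x ∈ vset P ↔ ∃ c ∈ P, c.vtx = x := by
  simp [vset]

/-- `BK-Pivot` reports the union of `R` with each maximal clique. -/
lemma bkPivot_out (G : SimpleGraph (Fin n)) (P₀ : Finset (Fin n)) :
    ∀ (fuel : ℕ) (P : List (Cand n)) (R : List (Fin n)) (X : List (Cand n)),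
      CandInv G P₀ P X → P.length < fuel → (bkPivot fuel P R X).out =
        ∑ K ∈ restrictedCliques G (vset P) (vset X), {R.toFinset ∪ K} := by
  intro fuel
  induction fuel with
  | zero => intro P R X _ h; exact absurd h (Nat.not_lt_zero _)
  | succ fuel ih =>
    intro P R X h hlen
    by_cases hne : P ++ X = []
    · obtain ⟨rfl, rfl⟩ := List.append_eq_nil_iff.1 hne
      rw [bkPivot_nil_out]
      simp [vset, restrictedCliques_empty]
    · obtain ⟨u, hu, hmax, hout, -⟩ := bkPivot_level hne fuel R
      have hlt : ∀ v ∈ branching P u, (childP P u v).length < fuel := fun v hv => by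
        have h1 := h.length_branching_add_childP_le hmax hv
        have h2 := List.length_pos_of_mem hv
        omega
      rw [hout, List.map_congr_left fun v hv => ih _ _ _ (h.child u v) (hlt v hv)]
      have hmem : ∀ {w}, w ∈ P → w ∈ P ++ X := fun hw => by simp [hw]
      have hmemX : ∀ {w}, w ∈ X → w ∈ P ++ X := fun hw => by simp [hw]
      have hQ : ∀ {w}, w ∈ vset (branching P u) ↔ w ∈ vset P ∧ ¬ G.Adj u.vtx w := by
        intro w
        simp only [mem_vset, branching, List.mem_filter, Bool.not_eq_eq_eq_not, Bool.not_true,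
          decide_eq_false_iff_not]
        constructor
        · rintro ⟨c, ⟨hc, h1⟩, rfl⟩
          exact ⟨⟨c, hc, rfl⟩, by rwa [← h.adj u hu _ (h.sub c hc)]⟩
        · rintro ⟨⟨c, hc, rfl⟩, h1⟩
          exact ⟨c, ⟨hc, by rwa [h.adj u hu _ (h.sub c hc)]⟩, rfl⟩
      rw [sum_restrictedCliques G (Q := vset (branching P u)) (f := id) (fun w hw => (hQ.1 hw).1)
        Function.injective_id]
      · have hnd : ((branching P u).map Cand.vtx).Nodup := by
          refine List.Nodup.map_on (fun c hc c' hc' => h.inj c (hmem (List.mem_of_mem_filter hc)) c'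
            (hmem (List.mem_of_mem_filter hc'))) ?_
          exact (List.nodup_append'.1 h.nodup).1.filter _
        have hsum : ∀ g : Fin n → Multiset (Finset (Fin n)), ∑ v ∈ vset (branching P u), g v =
            ((branching P u).map fun v => g v.vtx).sum := fun g => by
          rw [vset, List.sum_toFinset _ hnd, List.map_map]; rfl
        rw [hsum]
        classical
        refine congrArg List.sum (List.map_congr_left fun v hv => ?_)
        have hvP : v ∈ P := List.mem_of_mem_filter hv
        have e1 : vset (childP P u v) = (vset P).filter fun w =>
            G.Adj v.vtx w ∧ (w ∈ vset (branching P u) → v.vtx < w) := by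
          ext w
          simp only [Finset.mem_filter, hQ]
          constructor
          · intro hw
            obtain ⟨c, hc, rfl⟩ := mem_vset.1 hw
            have hcP := childP_subset P u v hc
            have h1 : c.vtx ∈ vset P := mem_vset.2 ⟨c, hcP, rfl⟩
            have h2 := h.adj c (hmem hcP) v.vtx (h.sub v hvP)
            have h3 := h.adj u hu c.vtx (h.sub c hcP)
            simp [childP, branching, common, hcP] at hc
            rw [G.adj_comm]
            tauto
          · rintro ⟨hw, h1, h4⟩
            obtain ⟨c, hcP, rfl⟩ := mem_vset.1 hw
            refine mem_vset.2 ⟨c, ?_, rfl⟩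
            have h2 := h.adj c (hmem hcP) v.vtx (h.sub v hvP)
            have h3 := h.adj u hu c.vtx (h.sub c hcP)
            simp [childP, branching, common, hcP]
            rw [G.adj_comm] at h1
            tauto
        have e2 : vset (childX P X u v) = (vset P ∪ vset X).filter fun w =>
            G.Adj v.vtx w ∧ (w ∈ vset X ∨ (w ∈ vset (branching P u) ∧ w < v.vtx)) := by
          ext w
          simp only [Finset.mem_filter, hQ, Finset.mem_union]
          constructor
          · intro hw
            obtain ⟨c, hc, rfl⟩ := mem_vset.1 hw
            simp only [childX, branching, List.mem_filter, List.mem_append, decide_eq_true_eq,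
              Bool.not_eq_eq_eq_not, Bool.not_true, decide_eq_false_iff_not] at hc
            obtain ⟨hc | ⟨⟨hcP, h4⟩, h5⟩, h1⟩ := hc
            · have h2 := h.adj c (hmemX hc) v.vtx (h.sub v hvP)
              have h3 : c.vtx ∈ vset X := mem_vset.2 ⟨c, hc, rfl⟩
              rw [G.adj_comm]
              tauto
            · have h2 := h.adj c (hmem hcP) v.vtx (h.sub v hvP)
              have h3 := h.adj u hu c.vtx (h.sub c hcP)
              have h6 : c.vtx ∈ vset P := mem_vset.2 ⟨c, hcP, rfl⟩
              rw [G.adj_comm]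
              tauto
          · rintro ⟨-, h1, hw | ⟨⟨hw, h4⟩, h5⟩⟩
            · obtain ⟨c, hc, rfl⟩ := mem_vset.1 hw
              have h2 := h.adj c (hmemX hc) v.vtx (h.sub v hvP)
              rw [G.adj_comm] at h1
              refine mem_vset.2 ⟨c, ?_, rfl⟩
              simp [childX, hc, h2, h1]
            · obtain ⟨c, hcP, rfl⟩ := mem_vset.1 hw
              have h2 := h.adj c (hmem hcP) v.vtx (h.sub v hvP)
              have h3 := h.adj u hu c.vtx (h.sub c hcP)
              rw [G.adj_comm] at h1
              refine mem_vset.2 ⟨c, ?_, rfl⟩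
              simp [childX, branching, hcP, h2, h1, h3, h4, h5]
        rw [e1, e2]
        simp only [id, List.toFinset_cons, Finset.insert_union, Finset.union_insert]
      · intro K hK
        obtain ⟨v, hv, h1⟩ := exists_mem_not_adj_pivot hK (u := u.vtx) (by
          rw [List.mem_append] at hu
          rw [Finset.mem_union, mem_vset, mem_vset]
          exact hu.imp (fun h => ⟨u, h, rfl⟩) fun h => ⟨u, h, rfl⟩)
        exact ⟨v, hQ.2 ⟨(mem_restrictedCliques.1 hK).1 hv, h1⟩, hv⟩

end Output

/-! ### Work and depth of `BK-Pivot` -/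

section Costs

open Comp

variable {n : ℕ}

/-- The depth of the recursion is at most the size of `P`. -/
lemma bkPivot_depth_le {G : SimpleGraph (Fin n)} {P₀ : Finset (Fin n)} (N : ℕ) :
    ∀ (fuel : ℕ) (P : List (Cand n)) (R : List (Fin n)) (X : List (Cand n)),
      CandInv G P₀ P X → P.length + X.length ≤ N → (∀ c ∈ P ++ X, c.nbr.length ≤ N) →
      (bkPivot fuel P R X).depth ≤
        (P.length + 1) * (100 * (Nat.clog 2 N + 1)) + (3 + R.length + P.length) := by
  intro fuel
  induction fuel with
  | zero => intro P R X _ _ _; simp [bkPivot]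
  | succ fuel ih =>
    intro P R X h hN hD
    by_cases hne : P ++ X = []
    · obtain ⟨rfl, rfl⟩ := List.append_eq_nil_iff.1 hne
      rw [bkPivot_nil_depth]
      simp
    · obtain ⟨u, hu, hmax, -, -, hdepth⟩ := bkPivot_level hne fuel R
      have h1 := hdepth N (P.length * (100 * (Nat.clog 2 N + 1)) + (3 + R.length + P.length)) hN hD
        fun v hv => by
          have h2 := h.length_branching_add_childP_le hmax hv
          have h3 := List.length_pos_of_mem hv
          have h4 := h.length_child_le u v
          have h5 := ih _ (v.vtx :: R) _ (h.child u v) (by omega)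
            fun c hc => hD c (childP_append_childX_subset P X u v hc)
          have h6 := Nat.mul_le_mul_right (100 * (Nat.clog 2 N + 1))
            (show (childP P u v).length + 1 ≤ P.length by omega)
          rw [List.length_cons] at h5
          omega
      rw [add_mul]
      omega

/-- The cube root of three. -/
noncomputable def cbrtThree : ℝ := 3 ^ ((1 : ℝ) / 3)

lemma cbrtThree_pow (k : ℕ) : cbrtThree ^ k = 3 ^ ((k : ℝ) / 3) := by
  rw [cbrtThree, ← Real.rpow_natCast, ← Real.rpow_mul (by norm_num)]
  congr 1; ring

lemma cbrtThree_pow_three : cbrtThree ^ 3 = 3 := by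
  rw [cbrtThree_pow]; norm_num

lemma one_lt_cbrtThree : 1 < cbrtThree := by
  rw [cbrtThree]; exact Real.one_lt_rpow (by norm_num) (by norm_num)

lemma pow_three_le_three_pow (k : ℕ) : k ^ 3 ≤ 3 ^ k := by
  rcases lt_or_ge k 3 with hk | hk
  · interval_cases k <;> norm_num
  · induction k, hk using Nat.le_induction with
    | base => norm_num
    | succ k hk ih =>
      rw [pow_succ 3 k]
      nlinarith [mul_le_mul hk hk (by norm_num) (by omega)]

lemma natCast_le_cbrtThree_pow (k : ℕ) : (k : ℝ) ≤ cbrtThree ^ k := by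
  have h : (k : ℝ) ^ 3 ≤ (cbrtThree ^ k) ^ 3 := by
    rw [← pow_mul, mul_comm, pow_mul, cbrtThree_pow_three]
    exact_mod_cast pow_three_le_three_pow k
  exact le_of_pow_le_pow_left₀ (by norm_num) (pow_nonneg (by linarith [one_lt_cbrtThree]) k) h

/-- The polynomial costs of the levels of the recursion, weighted by the number of leaves. -/
noncomputable def levelSum (p : ℕ) : ℝ := ∑ j ∈ Finset.range (p + 1), ((j : ℝ) + 1) / cbrtThree ^ j

lemma levelSum_term_nonneg (j : ℕ) : 0 ≤ ((j : ℝ) + 1) / cbrtThree ^ j :=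
  div_nonneg (by positivity) (pow_nonneg (by linarith [one_lt_cbrtThree]) j)

lemma levelSum_mono : Monotone levelSum := fun _ _ h =>
  Finset.sum_le_sum_of_subset_of_nonneg (Finset.range_mono (Nat.add_le_add_right h 1))
    fun j _ _ => levelSum_term_nonneg j

lemma one_le_levelSum (p : ℕ) : 1 ≤ levelSum p := by
  refine le_trans ?_ (levelSum_mono (Nat.zero_le p))
  simp [levelSum]

lemma exists_levelSum_le : ∃ S, ∀ p, levelSum p ≤ S := by
  have h0 : 0 < cbrtThree := by linarith [one_lt_cbrtThree]
  have h1 : ‖cbrtThree⁻¹‖ < 1 := by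
    rw [norm_inv, Real.norm_of_nonneg h0.le]
    exact inv_lt_one_of_one_lt₀ one_lt_cbrtThree
  have h2 : Summable fun j : ℕ => ((j : ℝ) + 1) / cbrtThree ^ j := by
    have := (summable_pow_mul_geometric_of_norm_lt_one 1 h1).add
      (summable_pow_mul_geometric_of_norm_lt_one 0 h1)
    refine this.congr fun j => ?_
    rw [inv_pow, pow_one, pow_zero, div_eq_mul_inv]; ring
  exact ⟨_, fun p => h2.sum_le_tsum _ fun j _ => levelSum_term_nonneg j⟩

/-- The work of `BK-Pivot` when `P ∪ X` has at most `s` vertices, the arrays of neighbours have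
at most `D` entries, and the reported cliques have at most `D + 1` vertices. -/
lemma bkPivot_work_le {G : SimpleGraph (Fin n)} {P₀ : Finset (Fin n)} (s D : ℕ) :
    ∀ (fuel : ℕ) (P : List (Cand n)) (R : List (Fin n)) (X : List (Cand n)),
      CandInv G P₀ P X → P.length + X.length ≤ s → (∀ c ∈ P ++ X, c.nbr.length ≤ D) →
      R.length + P.length ≤ D + 1 →
      ((bkPivot fuel P R X).work : ℝ) ≤
        100 * ((s + 1) * (D + 1)) * (cbrtThree ^ P.length * levelSum P.length) := by
  have h0 : 0 < cbrtThree := by linarith [one_lt_cbrtThree]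
  have hA : (0 : ℝ) < 100 * ((s + 1) * (D + 1)) := by positivity
  set A : ℝ := 100 * ((s + 1) * (D + 1)) with hA'
  intro fuel
  induction fuel with
  | zero =>
    intro P R X _ _ _ _
    have := one_le_levelSum P.length
    simp only [bkPivot, pure_work, Nat.cast_zero]
    positivity
  | succ fuel ih =>
    intro P R X h hs hD hR
    by_cases hne : P ++ X = []
    · obtain ⟨rfl, rfl⟩ := List.append_eq_nil_iff.1 hne
      rw [bkPivot_nil_work]
      have h1 : (R.length : ℝ) ≤ D + 1 := by exact_mod_cast (by simpa using hR)
      have h2 := one_le_levelSum 0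
      have h3 : (4 + D : ℝ) ≤ A := by
        rw [hA']; nlinarith [(Nat.cast_nonneg s : (0 : ℝ) ≤ s), (Nat.cast_nonneg D : (0 : ℝ) ≤ D),
          mul_nonneg (Nat.cast_nonneg s : (0 : ℝ) ≤ s) (Nat.cast_nonneg D : (0 : ℝ) ≤ D)]
      simp only [List.length_nil, pow_zero, one_mul]
      push_cast
      nlinarith
    · obtain ⟨u, hu, hmax, -, hwork, -⟩ := bkPivot_level hne fuel R
      set p := P.length with hp
      set k := (branching P u).length with hk
      have h1 := hwork D hD
      have h2 : (100 * ((p + X.length + 1) * (D + 1)) * (p + 1) : ℝ) ≤ A * (p + 1) := by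
        have : ((p : ℝ) + X.length) ≤ s := by exact_mod_cast hs
        rw [hA']; gcongr
      have h3 : ((((branching P u).map fun v =>
          (bkPivot fuel (childP P u v) (v.vtx :: R) (childX P X u v)).work).sum : ℕ) : ℝ) ≤
          A * (cbrtThree ^ p * ∑ j ∈ Finset.range p, ((j : ℝ) + 1) / cbrtThree ^ j) := by
        rcases Nat.eq_zero_or_pos k with hk0 | hk0
        · have hnil : branching P u = [] := List.length_eq_zero_iff.1 (hk.symm.trans hk0)
          rw [hnil]
          have : 0 ≤ ∑ j ∈ Finset.range p, ((j : ℝ) + 1) / cbrtThree ^ j :=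
            Finset.sum_nonneg fun j _ => levelSum_term_nonneg j
          simp only [List.map_nil, List.sum_nil, Nat.cast_zero]
          positivity
        have hkp : k ≤ p := List.length_filter_le _ _
        have h4 : ∀ v ∈ branching P u,
            ((bkPivot fuel (childP P u v) (v.vtx :: R) (childX P X u v)).work : ℝ) ≤
            A * (cbrtThree ^ (p - k) * levelSum (p - 1)) := fun v hv => by
          have h2 := h.length_branching_add_childP_le hmax hv
          have h4 := h.length_child_le u v
          refine (ih _ (v.vtx :: R) _ (h.child u v) (by omega)
            (fun c hc => hD c (childP_append_childX_subset P X u v hc))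
            (by rw [List.length_cons]; omega)).trans ?_
          refine mul_le_mul_of_nonneg_left ?_ hA.le
          refine mul_le_mul (pow_le_pow_right₀ one_lt_cbrtThree.le (by omega))
            (levelSum_mono (by omega)) (by linarith [one_le_levelSum (childP P u v).length])
            (by positivity)
        have h5 : ((((branching P u).map fun v =>
          (bkPivot fuel (childP P u v) (v.vtx :: R) (childX P X u v)).work).sum : ℕ) : ℝ) ≤
            k * (A * (cbrtThree ^ (p - k) * levelSum (p - 1))) := by
          rw [Nat.cast_list_sum, List.map_map]
          have := List.sum_le_card_nsmul ((branching P u).map (Nat.cast ∘ fun v =>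
            (bkPivot fuel (childP P u v) (v.vtx :: R) (childX P X u v)).work))
            (A * (cbrtThree ^ (p - k) * levelSum (p - 1))) (by simpa using h4)
          simpa using this
        refine h5.trans ?_
        have h6 : levelSum (p - 1) = ∑ j ∈ Finset.range p, ((j : ℝ) + 1) / cbrtThree ^ j := by
          rw [levelSum, Nat.sub_add_cancel (by omega)]
        rw [← h6]
        have h7 : k * cbrtThree ^ (p - k) ≤ cbrtThree ^ p := by
          conv_rhs => rw [← Nat.add_sub_cancel' hkp, pow_add]
          exact mul_le_mul_of_nonneg_right (natCast_le_cbrtThree_pow k) (by positivity)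
        have h8 := mul_le_mul_of_nonneg_right h7
          (mul_nonneg hA.le (by linarith [one_le_levelSum (p - 1)] : 0 ≤ levelSum (p - 1)))
        linarith
      have h4 : ((bkPivot (fuel + 1) P R X).work : ℝ) ≤
          (100 * ((p + X.length + 1) * (D + 1)) * (p + 1) : ℝ) +
          (((branching P u).map fun v =>
          (bkPivot fuel (childP P u v) (v.vtx :: R) (childX P X u v)).work).sum : ℕ) := by
        exact_mod_cast h1
      have h5 : A * (cbrtThree ^ p * levelSum p) = A * (p + 1) +
          A * (cbrtThree ^ p * ∑ j ∈ Finset.range p, ((j : ℝ) + 1) / cbrtThree ^ j) := by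
        rw [levelSum, Finset.sum_range_succ]
        field_simp
        ring
      linarith

end Costs

/-! ### Degeneracy -/

section Degeneracy

variable {V : Type*} [Fintype V]

open Classical in
/-- The degree of `v` in the subgraph induced by `U`. -/
noncomputable def degOn (G : SimpleGraph V) (U : Finset V) (v : V) : ℕ :=
  (U.filter fun w => G.Adj v w).card

lemma exists_ncard_neighborSet_le_degeneracy (G : SimpleGraph V) (H : G.Subgraph)
    (hH : H.verts.Nonempty) : ∃ v ∈ H.verts, (H.neighborSet v).ncard ≤ degeneracy G := by
  have h : degeneracy G ∈ {d : ℕ | ∀ H : G.Subgraph, H.verts.Nonempty →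
      ∃ v ∈ H.verts, (H.neighborSet v).ncard ≤ d} := by
    refine Nat.sInf_mem ⟨Fintype.card V, fun H ⟨v, hv⟩ => ⟨v, hv, ?_⟩⟩
    rw [← Nat.card_eq_fintype_card, ← Set.ncard_univ]
    exact Set.ncard_le_ncard (Set.subset_univ _)
  exact h H hH

lemma exists_degOn_le_degeneracy (G : SimpleGraph V) {U : Finset V} (hU : U.Nonempty) :
    ∃ v ∈ U, degOn G U v ≤ degeneracy G := by
  obtain ⟨v, hv, h⟩ := exists_ncard_neighborSet_le_degeneracy G
    ((⊤ : G.Subgraph).induce (U : Set V)) (by simpa using hU)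
  have hv' : v ∈ U := by simpa using hv
  refine ⟨v, hv', ?_⟩
  rw [degOn, ← Set.ncard_coe_finset]
  convert h using 2
  ext w
  simp [hv']

/-- The subgraph induced by `U` has at most `d |U|` edges. -/
lemma sum_degOn_le (G : SimpleGraph V) (U : Finset V) :
    ∑ v ∈ U, degOn G U v ≤ 2 * degeneracy G * U.card := by
  classical
  induction U using Finset.strongInduction with
  | H U ih =>
    rcases U.eq_empty_or_nonempty with rfl | hU
    · simp
    obtain ⟨v, hv, hd⟩ := exists_degOn_le_degeneracy G hU
    have h1 : ∀ w ∈ U.erase v, degOn G U w = degOn G (U.erase v) w +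
        if G.Adj v w then 1 else 0 := by
      intro w _
      have : U.filter (fun x => G.Adj w x) = (U.erase v).filter (fun x => G.Adj w x) ∪
          if G.Adj v w then {v} else ∅ := by
        ext x
        by_cases hxv : x = v
        · subst hxv
          by_cases h : G.Adj x w <;> simp [h, hv, G.adj_comm w x]
        · by_cases h : G.Adj v w <;> simp [h, hxv]
      rw [degOn, this, Finset.card_union_of_disjoint, degOn]
      · split_ifs <;> simp
      · split_ifs <;> simp
    have h2 : ∑ w ∈ U.erase v, (if G.Adj v w then 1 else 0) = degOn G U v := by
      rw [← Finset.card_filter, degOn]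
      congr 1
      ext w
      simp only [Finset.mem_filter, Finset.mem_erase]
      exact ⟨fun h => ⟨h.1.2, h.2⟩, fun h => ⟨⟨h.2.ne', h.1⟩, h.2⟩⟩
    rw [← Finset.add_sum_erase U _ hv, Finset.sum_congr rfl h1, Finset.sum_add_distrib, h2]
    have h3 := ih _ (Finset.erase_ssubset hv)
    have h4 : U.card = (U.erase v).card + 1 := (Finset.card_erase_add_one hv).symm
    rw [h4, mul_add]
    omega

lemma sum_degOn_univ (G : SimpleGraph V) :
    ∑ v, degOn G Finset.univ v = 2 * G.edgeSet.ncard := by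
  classical
  rw [← SimpleGraph.coe_edgeFinset, Set.ncard_coe_finset, ← G.sum_degrees_eq_twice_card_edges]
  refine Finset.sum_congr rfl fun v _ => ?_
  rw [degOn, SimpleGraph.degree]
  congr 1
  ext w
  simp

lemma ncard_edgeSet_le (G : SimpleGraph V) :
    G.edgeSet.ncard ≤ degeneracy G * Fintype.card V := by
  have h1 := sum_degOn_univ G
  have h2 := sum_degOn_le G Finset.univ
  rw [Finset.card_univ] at h2
  nlinarith

end Degeneracy

/-! ### One round of the approximate degeneracy ordering -/

section Round

open Comp

variable {ω : Type} {n : ℕ}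

/-- The sum of the degrees inside the working set. -/
def totalDegree (U : List (Fin n)) (N : Fin n → List (Fin n)) : ℕ :=
  (U.map fun v => (N v).length).foldr (· + ·) 0

/-- The vertices that leave the working set. -/
noncomputable def lowDegree (δ : ℝ) (U : List (Fin n)) (N : Fin n → List (Fin n)) :
    List (Fin n) :=
  U.filter fun v => decide (((N v).length : ℝ) ≤ (1 + δ) * (totalDegree U N / U.length))

/-- The ranks after the round `i`. -/
noncomputable def nextRank (δ : ℝ) (i : ℕ) (U : List (Fin n)) (N : Fin n → List (Fin n))
    (η : Fin n → ℕ) : Fin n → ℕ :=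
  fun v => if v ∈ lowDegree δ U N then i else η v

/-- The working set after the round `i`. -/
noncomputable def nextU (δ : ℝ) (i : ℕ) (U : List (Fin n)) (N : Fin n → List (Fin n))
    (η : Fin n → ℕ) : List (Fin n) :=
  U.filter fun v => nextRank δ i U N η v == 0

/-- The arrays of neighbours after the round `i`. -/
noncomputable def nextN (δ : ℝ) (i : ℕ) (U : List (Fin n)) (N : Fin n → List (Fin n))
    (η : Fin n → ℕ) : Fin n → List (Fin n) :=
  fun v => if v ∈ nextU δ i U N η then (N v).filter fun w => nextRank δ i U N η w == 0 else N v

lemma adgLoop_nil (δ : ℝ) (fuel i : ℕ) (N : Fin n → List (Fin n)) (η : Fin n → ℕ) :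
    (adgLoop δ fuel i [] N η : Comp ω _).val = η ∧
    (adgLoop δ fuel i [] N η : Comp ω _).work ≤ 1 ∧
    (adgLoop δ fuel i [] N η : Comp ω _).depth ≤ 1 ∧
    (adgLoop δ fuel i [] N η : Comp ω _).out = 0 := by
  cases fuel <;> simp [adgLoop]

/-- One round, followed by the computation `rest`. -/
noncomputable def adgRound (δ : ℝ) (i : ℕ) (U : List (Fin n)) (N : Fin n → List (Fin n))
    (η : Fin n → ℕ) (rest : Comp ω (Fin n → ℕ)) : Comp ω (Fin n → ℕ) := do
  let _ ← instr U.isEmpty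
  let degrees ← parMap (fun v => instr (N v).length) U
  let _ ← reduce (· + ·) 0 degrees
  let average ← instr ((totalDegree U N : ℝ) / (U.length : ℝ))
  let _ ← parFilter (fun v => do
    let deg ← instr (N v).length
    instr (decide ((deg : ℝ) ≤ (1 + δ) * average))) U
  let _ ← store (lowDegree δ U N) (fun _ => instr i) η
  let _ ← parFilter (fun v => instr (nextRank δ i U N η v == 0)) U
  let _ ← store (nextU δ i U N η) (fun v => do
    let Nv ← instr (N v)
    parFilter (fun w => instr (nextRank δ i U N η w == 0)) Nv) N
  let _ ← instr (i + 1)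
  rest

lemma adgLoop_succ (δ : ℝ) (fuel i : ℕ) {U : List (Fin n)} (hU : U ≠ [])
    (N : Fin n → List (Fin n)) (η : Fin n → ℕ) :
    (adgLoop δ (fuel + 1) i U N η : Comp ω _) = adgRound δ i U N η
      (adgLoop δ fuel (i + 1) (nextU δ i U N η) (nextN δ i U N η) (nextRank δ i U N η)) := by
  have hlow : ∀ t : ℝ, t = totalDegree U N / U.length → (parFilter (fun v => do
      let deg ← instr (N v).length
      instr (decide ((deg : ℝ) ≤ (1 + δ) * t))) U :
        Comp ω _).val = lowDegree δ U N := by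
    rintro t rfl
    simp only [parFilter_val, bind_val, instr_val]
    rfl
  have hnext : (parFilter (fun v => instr (nextRank δ i U N η v == 0)) U : Comp ω _).val =
      nextU δ i U N η := by
    simp only [parFilter_val, instr_val]
    rfl
  have hnextN : (store (nextU δ i U N η) (fun v => do
      let Nv ← instr (N v)
      parFilter (fun w => instr (nextRank δ i U N η w == 0)) Nv) N : Comp ω _).val =
      nextN δ i U N η := by
    simp only [store_val, bind_val, parFilter_val, instr_val]
    rfl
  have hrank : (store (lowDegree δ U N) (fun _ => instr i) η : Comp ω _).val =
      nextRank δ i U N η := rfl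
  have hU' : U.isEmpty = false := by simpa using hU
  have bind_congr : ∀ {α β : Type} (x : Comp ω α) (f g : α → Comp ω β), f x.val = g x.val →
      x >>= f = x >>= g := by
    intro α β x f g h
    simp only [Bind.bind, h]
  rw [adgLoop, adgRound]
  refine bind_congr _ _ _ ?_
  rw [instr_val, hU']
  simp only [Bool.false_eq_true, if_false]
  refine bind_congr _ _ _ <| bind_congr _ _ _ <| bind_congr _ _ _ <| bind_congr _ _ _ ?_
  rw [hlow _ (by rw [instr_val]; rfl)]
  refine bind_congr _ _ _ ?_
  rw [hrank]
  refine bind_congr _ _ _ ?_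
  rw [hnext]
  refine bind_congr _ _ _ ?_
  rw [hnextN]
  rfl

lemma totalDegree_eq_sum (U : List (Fin n)) (N : Fin n → List (Fin n)) :
    totalDegree U N = (U.map fun v => (N v).length).sum := rfl

lemma adgRound_val (δ : ℝ) (i : ℕ) (U : List (Fin n)) (N : Fin n → List (Fin n))
    (η : Fin n → ℕ) (rest : Comp ω (Fin n → ℕ)) : (adgRound δ i U N η rest).val = rest.val := rfl

lemma adgRound_out (δ : ℝ) (i : ℕ) (U : List (Fin n)) (N : Fin n → List (Fin n))
    (η : Fin n → ℕ) (rest : Comp ω (Fin n → ℕ)) : (adgRound δ i U N η rest).out = rest.out := by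
  simp only [adgRound, bind_out, instr_out, parMap_out, reduce_out, store_out, zero_add]
  rw [parFilter_out (by simp), parFilter_out (by simp), sum_map_eq_zero (by simp),
    sum_map_eq_zero (by simp), sum_map_eq_zero fun v _ => parFilter_out (by simp)]
  simp

lemma length_nextU_le (δ : ℝ) (i : ℕ) (U : List (Fin n)) (N : Fin n → List (Fin n))
    (η : Fin n → ℕ) : (nextU δ i U N η).length ≤ U.length := List.length_filter_le _ _

lemma adgRound_work_le (δ : ℝ) (i : ℕ) (U : List (Fin n)) (N : Fin n → List (Fin n))
    (η : Fin n → ℕ) (rest : Comp ω (Fin n → ℕ)) :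
    (adgRound δ i U N η rest).work ≤
      20 + 30 * U.length + 4 * totalDegree U N + rest.work := by
  have h1 : (lowDegree δ U N).length ≤ U.length := List.length_filter_le _ _
  have h2 := length_nextU_le δ i U N η
  have h3 : ((nextU δ i U N η).map fun v => (N v).length).sum ≤ totalDegree U N :=
    (List.filter_sublist.map _).sum_le_sum (by simp)
  have e : (fun v => 2 + 3 * (N v).length + (N v).length * 1) =
    fun v => 2 + 4 * (N v).length := by funext v; ring
  simp only [adgRound, bind_work, instr_work, parMap_work, reduce_work, store_work,
    parFilter_work, instr_val, parMap_val, List.length_map, e, sum_map_const_add,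
    List.sum_map_mul_left, List.map_const', List.sum_replicate, smul_eq_mul]
  omega

lemma adgRound_depth_le (δ : ℝ) (i : ℕ) {U : List (Fin n)} {N : Fin n → List (Fin n)}
    {M : ℕ} (hU : U.length ≤ M) (hN : ∀ v ∈ U, (N v).length ≤ M)
    (η : Fin n → ℕ) (rest : Comp ω (Fin n → ℕ)) :
    (adgRound δ i U N η rest).depth ≤ 100 * (Nat.clog 2 M + 1) + rest.depth := by
  have h1 : (lowDegree δ U N).length ≤ U.length := List.length_filter_le _ _
  have h2 := length_nextU_le δ i U N η
  have h3 : (parMap (fun v => instr (N v).length) U : Comp ω _).depth ≤ 1 + Nat.clog 2 M + 1 :=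
    parMap_depth_le hU fun v _ => by simp
  have h4 : (reduce (· + ·) 0 (parMap (fun v => instr (N v).length) U : Comp ω _).val :
      Comp ω _).depth ≤ 1 + Nat.clog 2 M := reduce_depth_le _ _ (by simpa using hU)
  have h5 : ∀ p : Fin n → Comp ω Bool, (∀ v, (p v).depth ≤ 2) → (parFilter p U).depth ≤
      3 + 2 * Nat.clog 2 M + 2 := fun p hp => parFilter_depth_le hU fun v _ => hp v
  have h6 : (store (lowDegree δ U N) (fun _ => instr i) η : Comp ω _).depth ≤
    2 + Nat.clog 2 M + 1 := store_depth_le (by omega) fun v _ => by simp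
  have h7 : (store (nextU δ i U N η) (fun v => do
      let Nv ← instr (N v)
      parFilter (fun w => instr (nextRank δ i U N η w == 0)) Nv) N : Comp ω _).depth ≤
      2 + Nat.clog 2 M + (1 + (3 + 2 * Nat.clog 2 M + 1)) :=
    store_depth_le (by omega) fun v hv => Nat.add_le_add_left
      (parFilter_depth_le (hN v (List.mem_of_mem_filter hv)) fun w _ => by simp) 1
  have h8 := h5 (fun v => instr (nextRank δ i U N η v == 0)) fun v => by simp
  have h9 := h5 (fun v => do
    let deg ← instr (N v).length
    instr (decide ((deg : ℝ) ≤ (1 + δ) *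
      (instr ((totalDegree U N : ℝ) / (U.length : ℝ)) : Comp ω ℝ).val))) fun v => by simp
  simp only [adgRound, bind_depth, instr_depth]
  omega

end Round

/-! ### Ranks, work and depth of the approximate degeneracy ordering -/

section ADGBounds

open Comp

variable {ω : Type} {n : ℕ}

/-- The state before the round `i`: the vertices of the working set `U` have no rank yet, the
others have a smaller rank, and `N` lists the neighbours inside `U`. -/
structure AdgInv (G : SimpleGraph (Fin n)) (i : ℕ) (U : List (Fin n)) (N : Fin n → List (Fin n))
    (η : Fin n → ℕ) : Prop where
  nodup : U.Nodup
  mem : ∀ v, v ∈ U ↔ η v = 0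
  lt : ∀ v, η v < i
  nbr_nodup : ∀ v ∈ U, (N v).Nodup
  mem_nbr : ∀ v ∈ U, ∀ w, w ∈ N v ↔ G.Adj v w ∧ w ∈ U

namespace AdgInv

variable {G : SimpleGraph (Fin n)} {i : ℕ} {U : List (Fin n)} {N : Fin n → List (Fin n)}
  {η : Fin n → ℕ}

lemma length_nbr (h : AdgInv G i U N η) {v : Fin n} (hv : v ∈ U) :
    (N v).length = degOn G U.toFinset v := by
  rw [← List.toFinset_card_of_nodup (h.nbr_nodup v hv), degOn]
  congr 1
  ext w
  simp [h.mem_nbr v hv, and_comm]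

lemma totalDegree_le (h : AdgInv G i U N η) :
    totalDegree U N ≤ 2 * degeneracy G * U.length := by
  have h1 := sum_degOn_le G U.toFinset
  rw [List.toFinset_card_of_nodup h.nodup, List.sum_toFinset _ h.nodup] at h1
  rwa [totalDegree_eq_sum, List.map_congr_left fun v hv => h.length_nbr hv]

lemma mem_nextU (h : AdgInv G i U N η) (δ : ℝ) (v : Fin n) :
    v ∈ nextU δ i U N η ↔ nextRank δ i U N η v = 0 := by
  have h1 := h.lt v
  rw [nextU, List.mem_filter, beq_iff_eq]
  refine ⟨And.right, fun h2 => ⟨?_, h2⟩⟩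
  rw [nextRank] at h2
  split_ifs at h2 with h3
  · omega
  · exact (h.mem v).2 h2

lemma mem_nextU_iff (h : AdgInv G i U N η) (δ : ℝ) (v : Fin n) :
    v ∈ nextU δ i U N η ↔ v ∈ U ∧ v ∉ lowDegree δ U N := by
  have h1 := h.lt v
  rw [h.mem_nextU, nextRank, h.mem v]
  split_ifs with h3
  · simp [h3]; omega
  · simp [h3]

lemma next (h : AdgInv G i U N η) (δ : ℝ) :
    AdgInv G (i + 1) (nextU δ i U N η) (nextN δ i U N η) (nextRank δ i U N η) where
  nodup := h.nodup.filter _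
  mem := h.mem_nextU δ
  lt v := by
    have := h.lt v
    rw [nextRank]
    split_ifs <;> omega
  nbr_nodup v hv := by
    rw [nextN, if_pos hv]
    exact (h.nbr_nodup v (List.mem_of_mem_filter hv)).filter _
  mem_nbr v hv w := by
    rw [nextN, if_pos hv, List.mem_filter, h.mem_nbr v (List.mem_of_mem_filter hv), beq_iff_eq,
      ← h.mem_nextU]
    exact ⟨fun h => ⟨h.1.1, h.2⟩, fun h => ⟨⟨h.1, List.mem_of_mem_filter h.2⟩, h.2⟩⟩

/-- At most a fraction of `1 / (1 + δ)` of the vertices remains in the working set. -/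
lemma length_nextU_mul_le (h : AdgInv G i U N η) {δ : ℝ} (hδ : 0 < δ) :
    (1 + δ) * ((nextU δ i U N η).length : ℝ) ≤ U.length := by
  rcases eq_or_ne (nextU δ i U N η) [] with hnil | hne
  · rw [hnil]; simp
  have hgt : ∀ v ∈ nextU δ i U N η,
      (1 + δ) * (totalDegree U N / U.length) < ((N v).length : ℝ) := by
    intro v hv
    obtain ⟨h1, h2⟩ := (h.mem_nextU_iff δ v).1 hv
    simpa [lowDegree, h1] using h2
  have hsub : ((nextU δ i U N η).map fun v => (N v).length).sum ≤ totalDegree U N :=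
    (List.filter_sublist.map _).sum_le_sum (by simp)
  obtain ⟨v, hv⟩ := List.exists_mem_of_ne_nil _ hne
  have hU : (0 : ℝ) < U.length := by
    exact_mod_cast List.length_pos_of_mem (List.mem_of_mem_filter hv)
  have htot : (0 : ℝ) < totalDegree U N := by
    have h1 := hgt v hv
    have h2 : (N v).length ≤ totalDegree U N :=
      (List.single_le_sum (by simp) _ (List.mem_map_of_mem hv)).trans hsub
    have h3 : (0 : ℝ) < (N v).length := lt_of_le_of_lt (by positivity) h1
    exact_mod_cast h3.trans_le (Nat.cast_le.2 h2)
  have h1 : ((nextU δ i U N η).length : ℝ) * ((1 + δ) * (totalDegree U N / U.length)) ≤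
      totalDegree U N := by
    have h2 := List.card_nsmul_le_sum ((nextU δ i U N η).map (Nat.cast ∘ fun v => (N v).length))
      ((1 + δ) * (totalDegree U N / U.length : ℝ)) (by simpa using fun v hv => (hgt v hv).le)
    rw [← List.map_map, ← Nat.cast_list_sum] at h2
    simp only [List.length_map, nsmul_eq_mul] at h2
    exact h2.trans (by exact_mod_cast hsub)
  have h2 : ((nextU δ i U N η).length : ℝ) * ((1 + δ) * (totalDegree U N / U.length)) =
      ((1 + δ) * ((nextU δ i U N η).length : ℝ) / U.length) * totalDegree U N := by ring
  rw [h2] at h1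
  have h3 := le_of_mul_le_mul_right (h1.trans_eq (one_mul _).symm) htot
  rwa [div_le_one hU] at h3

lemma length_nextU_lt (h : AdgInv G i U N η) {δ : ℝ} (hδ : 0 < δ) (hU : U ≠ []) :
    (nextU δ i U N η).length < U.length := by
  have h1 := h.length_nextU_mul_le hδ
  have h2 : (0 : ℝ) < U.length := by exact_mod_cast List.length_pos_of_ne_nil hU
  have h3 : (0 : ℝ) ≤ (nextU δ i U N η).length := Nat.cast_nonneg _
  have : ((nextU δ i U N η).length : ℝ) < U.length := by
    rcases h3.eq_or_lt with h4 | h4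
    · rwa [← h4]
    · nlinarith
  exact_mod_cast this

end AdgInv

lemma adgLoop_out (δ : ℝ) : ∀ (fuel i : ℕ) (U : List (Fin n)) (N : Fin n → List (Fin n))
    (η : Fin n → ℕ), (adgLoop δ fuel i U N η : Comp ω _).out = 0 := by
  intro fuel
  induction fuel with
  | zero => intro i U N η; rfl
  | succ fuel ih =>
    intro i U N η
    rcases eq_or_ne U [] with rfl | hU
    · exact (adgLoop_nil δ _ i N η).2.2.2
    · rw [adgLoop_succ δ fuel i hU, adgRound_out, ih]

open Classical in
/-- A vertex that is removed has few neighbours of the same or a later rank. -/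
lemma adgLoop_rank {G : SimpleGraph (Fin n)} {δ : ℝ} (hδ : 0 < δ) :
    ∀ (fuel i : ℕ) (U : List (Fin n)) (N : Fin n → List (Fin n)) (η : Fin n → ℕ),
      AdgInv G i U N η → U.length ≤ fuel →
      (∀ v, v ∉ U → (adgLoop δ fuel i U N η : Comp ω _).val v = η v) ∧
      ∀ v ∈ U, i ≤ (adgLoop δ fuel i U N η : Comp ω _).val v ∧
        ((Finset.univ.filter fun w => G.Adj v w ∧ (adgLoop δ fuel i U N η : Comp ω _).val v ≤
          (adgLoop δ fuel i U N η : Comp ω _).val w).card : ℝ) ≤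
            (1 + δ) * (2 * degeneracy G) := by
  intro fuel
  induction fuel with
  | zero =>
    intro i U N η _ hlen
    rw [List.length_eq_zero_iff.1 (Nat.le_zero.1 hlen)]
    exact ⟨fun v _ => rfl, by simp⟩
  | succ fuel ih =>
    intro i U N η h hlen
    rcases eq_or_ne U [] with rfl | hU
    · rw [(adgLoop_nil δ _ i N η).1]
      simp
    rw [adgLoop_succ δ fuel i hU, adgRound_val]
    obtain ⟨ih1, ih2⟩ := ih (i + 1) _ _ _ (h.next δ)
      (by have := h.length_nextU_lt hδ hU; omega)
    set η' := (adgLoop δ fuel (i + 1) (nextU δ i U N η) (nextN δ i U N η)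
      (nextRank δ i U N η) : Comp ω _).val
    have hout : ∀ v, v ∉ U → η' v = η v := fun v hv => by
      rw [ih1 v fun h' => hv (List.mem_of_mem_filter h'), nextRank,
        if_neg fun h' : v ∈ lowDegree δ U N => hv (List.mem_of_mem_filter h')]
    refine ⟨hout, fun v hv => ?_⟩
    by_cases hlow : v ∈ lowDegree δ U N
    · have e : η' v = i := by
        rw [ih1 v fun h' => ((h.mem_nextU_iff δ v).1 h').2 hlow, nextRank, if_pos hlow]
      rw [e]
      refine ⟨le_rfl, ?_⟩
      have h1 : (Finset.univ.filter fun w => G.Adj v w ∧ i ≤ η' w).card ≤ (N v).length := by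
        rw [← List.toFinset_card_of_nodup (h.nbr_nodup v hv)]
        refine Finset.card_le_card fun w hw => ?_
        obtain ⟨-, hw1, hw2⟩ := Finset.mem_filter.1 hw
        rw [List.mem_toFinset, h.mem_nbr v hv]
        refine ⟨hw1, ?_⟩
        by_contra hwU
        rw [hout w hwU] at hw2
        exact absurd (h.lt w) (not_lt.2 hw2)
      have h2 : ((N v).length : ℝ) ≤ (1 + δ) * (totalDegree U N / U.length) := by
        simpa [lowDegree, hv] using hlow
      have h3 : (0 : ℝ) < U.length := by exact_mod_cast List.length_pos_of_mem hv
      have h4 : (totalDegree U N / U.length : ℝ) ≤ 2 * degeneracy G := by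
        rw [div_le_iff₀ h3]; exact_mod_cast h.totalDegree_le
      calc _ ≤ ((N v).length : ℝ) := by exact_mod_cast h1
        _ ≤ _ := h2
        _ ≤ _ := by gcongr
    · obtain ⟨h1, h2⟩ := ih2 v ((h.mem_nextU_iff δ v).2 ⟨hv, hlow⟩)
      exact ⟨by omega, h2⟩

lemma adgLoop_work_le {G : SimpleGraph (Fin n)} {δ : ℝ} (hδ : 0 < δ) :
    ∀ (fuel i : ℕ) (U : List (Fin n)) (N : Fin n → List (Fin n)) (η : Fin n → ℕ),
      AdgInv G i U N η → ((adgLoop δ fuel i U N η : Comp ω _).work : ℝ) ≤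
        50 * ((1 + δ) / δ) * (degeneracy G + 1) * U.length + 1 := by
  intro fuel
  induction fuel with
  | zero =>
    intro i U N η _
    simp only [adgLoop, pure_work, Nat.cast_zero]
    positivity
  | succ fuel ih =>
    intro i U N η h
    rcases eq_or_ne U [] with rfl | hU
    · have := (adgLoop_nil (ω := ω) δ (fuel + 1) i N η).2.1
      simp only [List.length_nil, Nat.cast_zero, mul_zero, zero_add]
      exact_mod_cast this
    rw [adgLoop_succ δ fuel i hU]
    have h1 := adgRound_work_le δ i U N η (adgLoop δ fuel (i + 1) (nextU δ i U N η)
      (nextN δ i U N η) (nextRank δ i U N η) : Comp ω _)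
    have h2 := ih (i + 1) _ _ _ (h.next δ)
    have h3 := h.totalDegree_le
    have h4 : 1 ≤ U.length := List.length_pos_of_ne_nil hU
    have h5 := h.length_nextU_mul_le hδ
    set W := (adgLoop δ fuel (i + 1) (nextU δ i U N η)
      (nextN δ i U N η) (nextRank δ i U N η) : Comp ω _).work
    have h6 : ((20 + 30 * U.length + 4 * totalDegree U N : ℕ) : ℝ) ≤
        50 * ((degeneracy G + 1) * U.length) := by
      have : 20 + 30 * U.length + 4 * totalDegree U N ≤
          50 * ((degeneracy G + 1) * U.length) := by nlinarith
      exact_mod_cast this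
    have h7 : 50 * ((1 + δ) / δ) * (degeneracy G + 1) * ((nextU δ i U N η).length : ℝ) ≤
        50 * (1 / δ) * (degeneracy G + 1) * U.length := by
      calc _ = 50 * (1 / δ) * (degeneracy G + 1) *
            ((1 + δ) * ((nextU δ i U N η).length : ℝ)) := by ring
        _ ≤ _ := by gcongr
    have h8 : 50 * ((1 + δ) / δ) * (degeneracy G + 1) * (U.length : ℝ) =
        50 * (1 / δ) * (degeneracy G + 1) * U.length +
          50 * ((degeneracy G + 1) * U.length) := by
      field_simp
    have h9 : ((adgRound δ i U N η (adgLoop δ fuel (i + 1) (nextU δ i U N η)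
      (nextN δ i U N η) (nextRank δ i U N η) : Comp ω _)).work : ℝ) ≤
        ((20 + 30 * U.length + 4 * totalDegree U N : ℕ) : ℝ) + W := by exact_mod_cast h1
    linarith

/-- The number of rounds is logarithmic. -/
lemma adgLoop_depth_le {G : SimpleGraph (Fin n)} {δ : ℝ} (hδ : 0 < δ) :
    ∀ (fuel i : ℕ) (U : List (Fin n)) (N : Fin n → List (Fin n)) (η : Fin n → ℕ),
      AdgInv G i U N η → ((adgLoop δ fuel i U N η : Comp ω _).depth : ℝ) ≤
        1 + 100 * (Nat.clog 2 n + 1) * (Real.log U.length / Real.log (1 + δ) + 1) := by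
  have hlog : 0 < Real.log (1 + δ) := Real.log_pos (by linarith)
  have hnonneg : ∀ k : ℕ, 0 ≤ Real.log k / Real.log (1 + δ) :=
    fun k => div_nonneg (Real.log_natCast_nonneg k) hlog.le
  intro fuel
  induction fuel with
  | zero =>
    intro i U N η _
    have := hnonneg U.length
    simp only [adgLoop, pure_depth, Nat.cast_zero]
    positivity
  | succ fuel ih =>
    intro i U N η h
    have hB : (0 : ℝ) ≤ 100 * (Nat.clog 2 n + 1) := by positivity
    have hlen : ∀ {l : List (Fin n)}, l.Nodup → l.length ≤ n := fun hl => by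
      simpa using hl.length_le_card
    rcases eq_or_ne U [] with rfl | hU
    · have h1 : ((adgLoop δ (fuel + 1) i [] N η : Comp ω _).depth : ℝ) ≤ 1 := by
        exact_mod_cast (adgLoop_nil (ω := ω) δ (fuel + 1) i N η).2.2.1
      have h2 := hnonneg ([] : List (Fin n)).length
      nlinarith
    rw [adgLoop_succ δ fuel i hU]
    have h1 := adgRound_depth_le δ i (hlen h.nodup) (fun v hv => hlen (h.nbr_nodup v hv)) η
      (adgLoop δ fuel (i + 1) (nextU δ i U N η) (nextN δ i U N η) (nextRank δ i U N η) : Comp ω _)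
    have h2 : ((adgRound δ i U N η (adgLoop δ fuel (i + 1) (nextU δ i U N η)
      (nextN δ i U N η) (nextRank δ i U N η) : Comp ω _)).depth : ℝ) ≤
      100 * (Nat.clog 2 n + 1) + (adgLoop δ fuel (i + 1) (nextU δ i U N η)
      (nextN δ i U N η) (nextRank δ i U N η) : Comp ω _).depth := by exact_mod_cast h1
    refine h2.trans ?_
    rcases eq_or_ne (nextU δ i U N η) [] with hnil | hne
    · have h3 : ((adgLoop δ fuel (i + 1) (nextU δ i U N η)
          (nextN δ i U N η) (nextRank δ i U N η) : Comp ω _).depth : ℝ) ≤ 1 := by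
        rw [hnil]
        exact_mod_cast (adgLoop_nil (ω := ω) δ fuel (i + 1) _ _).2.2.1
      have := mul_nonneg hB (hnonneg U.length)
      linarith
    · have h3 := ih (i + 1) _ _ _ (h.next δ)
      have h4 : (0 : ℝ) < (nextU δ i U N η).length := by
        exact_mod_cast List.length_pos_of_ne_nil hne
      have h5 := Real.log_le_log (mul_pos (by linarith) h4) (h.length_nextU_mul_le hδ)
      rw [Real.log_mul (by linarith) h4.ne'] at h5
      have h6 : Real.log (nextU δ i U N η).length / Real.log (1 + δ) + 1 ≤
          Real.log U.length / Real.log (1 + δ) := by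
        rw [div_add_one hlog.ne']
        exact div_le_div_of_nonneg_right (by linarith) hlog.le
      have h7 := mul_le_mul_of_nonneg_left h6 hB
      linarith

lemma adgInv_init {G : SimpleGraph (Fin n)} {A : Fin n → List (Fin n)}
    (hA : IsAdjacencyArrays G A) : AdgInv G 1 (List.finRange n) A (fun _ => 0) where
  nodup := List.nodup_finRange n
  mem := by simp
  lt := by simp
  nbr_nodup v _ := (hA v).1
  mem_nbr v _ w := by simp [(hA v).2 w]

lemma adg_val (δ : ℝ) (A : Fin n → List (Fin n)) : (adg δ A : Comp ω _).val =
    (adgLoop δ n 1 (List.finRange n) A (fun _ => 0) : Comp ω _).val := by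
  simp [adg]

lemma adg_out (δ : ℝ) (A : Fin n → List (Fin n)) : (adg δ A : Comp ω _).out = 0 := by
  simp [adg, adgLoop_out]

lemma adg_work (δ : ℝ) (A : Fin n → List (Fin n)) : (adg δ A : Comp ω _).work =
    7 * n + 3 + (adgLoop δ n 1 (List.finRange n) A (fun _ => 0) : Comp ω _).work := by
  simp [adg, store_work]
  ring

lemma adg_depth_le (δ : ℝ) (A : Fin n → List (Fin n)) : (adg δ A : Comp ω _).depth ≤
    7 + 3 * Nat.clog 2 n +
      (adgLoop δ n 1 (List.finRange n) A (fun _ => 0) : Comp ω _).depth := by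
  have h : ∀ {β : Type} (f : Fin n → Comp ω β) (old : Fin n → β), (∀ v, (f v).depth ≤ 1) →
      (store (List.finRange n) f old).depth ≤ 2 + Nat.clog 2 n + 1 :=
    fun f old hf => store_depth_le (by simp) fun v _ => hf v
  have h1 := h (fun _ => instr 0) (fun _ => (0 : ℕ)) fun v => by simp
  have h2 := h (fun v => instr (A v)) (fun _ => []) fun v => by simp
  simp only [adg, bind_depth, vertices_depth, vertices_val, store_val, List.mem_finRange, if_true,
    instr_val]
  change _ + (_ + (_ + (adgLoop δ n 1 (List.finRange n) A (fun _ => 0) : Comp ω _).depth)) ≤ _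
  omega

end ADGBounds

/-! ### The outermost loop -/

section Outer

open Comp

variable {n : ℕ}

/-- The array of the neighbours of `v` that follow `v` in the order by rank. -/
def following (η : Fin n → ℕ) (A : Fin n → List (Fin n)) (v : Fin n) : List (Fin n) :=
  (A v).filter fun w => decide (η v < η w ∨ (η v = η w ∧ v < w))

/-- The array of the neighbours of `v` that precede `v` in the order by rank. -/
def preceding (η : Fin n → ℕ) (A : Fin n → List (Fin n)) (v : Fin n) : List (Fin n) :=
  (A v).filter fun w => decide (η w < η v ∨ (η w = η v ∧ w < v))

/-- The vertex `w` with the array of its neighbours in `P`. -/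
def cand (η : Fin n → ℕ) (A : Fin n → List (Fin n)) (P : List (Fin n)) (w : Fin n) : Cand n :=
  ⟨w, P.filter fun p => decide (p ∈ following η A w) || decide (w ∈ following η A p)⟩

/-- The branch of the outermost loop for the vertex `v`. -/
def vertexCall (η : Fin n → ℕ) (out A : Fin n → List (Fin n)) (v : Fin n) :
    Comp (Finset (Fin n)) Unit := do
  let Nv ← instr (A v)
  let P₀ ← parFilter (fun w => before η v w) Nv
  let X₀ ← parFilter (fun w => before η w v) Nv
  let P ← parMap (attach out P₀) P₀
  let X ← parMap (attach out P₀) X₀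
  let R ← instr [v]
  bkPivot n P R X

@[simp] lemma before_val {ω : Type} (η : Fin n → ℕ) (v w : Fin n) :
    (before η v w : Comp ω Bool).val = decide (η v < η w ∨ (η v = η w ∧ v < w)) := rfl

@[simp] lemma before_work {ω : Type} (η : Fin n → ℕ) (v w : Fin n) :
    (before η v w : Comp ω Bool).work = 3 := rfl

@[simp] lemma before_depth {ω : Type} (η : Fin n → ℕ) (v w : Fin n) :
    (before η v w : Comp ω Bool).depth = 3 := rfl

@[simp] lemma before_out {ω : Type} (η : Fin n → ℕ) (v w : Fin n) :
    (before η v w : Comp ω Bool).out = 0 := rfl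

lemma attach_val (η : Fin n → ℕ) (A : Fin n → List (Fin n)) (P : List (Fin n)) (w : Fin n) :
    (attach (following η A) P w).val = cand η A P w := by
  simp only [attach, cand, bind_val, instr_val, parFilter_val, parMem_val]

@[simp] lemma attach_out (out : Fin n → List (Fin n)) (P : List (Fin n)) (w : Fin n) :
    (attach out P w).out = 0 := by
  simp only [attach, bind_out, instr_out, zero_add, add_zero]
  exact parFilter_out (by simp)

lemma attach_work_le {out : Fin n → List (Fin n)} {D : ℕ} (hD : ∀ v, (out v).length ≤ D)
    {P : List (Fin n)} (hP : P.length ≤ D) (w : Fin n) :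
    (attach out P w).work ≤ 4 + D * (9 + 6 * D) := by
  have h : ∀ l : List (Fin n), l.length ≤ D → (parFilter (fun p => do
      let b ← parMem p l
      let outp ← instr (out p)
      let c ← parMem w outp
      instr (b || c)) P : Comp (Finset (Fin n)) _).work ≤ 2 + P.length * (3 + (6 + 6 * D)) :=
    fun l hl => parFilter_work_le fun p _ => by
      have := hD p
      simp only [bind_work, parMem_work, instr_work, instr_val]
      omega
  have h1 := h (out w) (hD w)
  have h2 := Nat.mul_le_mul_right (3 + (6 + 6 * D)) hP
  simp only [attach, bind_work, instr_work]
  change 1 + (_ + 1) ≤ _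
  rw [instr_val]
  linarith

lemma attach_depth_le {out : Fin n → List (Fin n)} {N : ℕ} (hN : ∀ v, (out v).length ≤ N)
    {P : List (Fin n)} (hP : P.length ≤ N) (w : Fin n) :
    (attach out P w).depth ≤ 13 + 6 * Nat.clog 2 N := by
  have h : ∀ l : List (Fin n), l.length ≤ N → (parFilter (fun p => do
      let b ← parMem p l
      let outp ← instr (out p)
      let c ← parMem w outp
      instr (b || c)) P : Comp (Finset (Fin n)) _).depth ≤
        3 + 2 * Nat.clog 2 N + (8 + 4 * Nat.clog 2 N) :=
    fun l hl => parFilter_depth_le hP fun p _ => by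
      have h1 := parMem_depth_le (ω := Finset (Fin n)) p hl
      have h2 := parMem_depth_le (ω := Finset (Fin n)) w (hN p)
      simp only [bind_depth, instr_depth, instr_val]
      omega
  have h1 := h (out w) (hN w)
  simp only [attach, bind_depth, instr_depth]
  change 1 + (_ + 1) ≤ _
  rw [instr_val]
  omega

lemma vertexCall_out (η : Fin n → ℕ) (A : Fin n → List (Fin n)) (v : Fin n) :
    (vertexCall η (following η A) A v).out =
      (bkPivot n ((following η A v).map (cand η A (following η A v))) [v]
        ((preceding η A v).map (cand η A (following η A v)))).out := by
  simp only [vertexCall, bind_out, instr_val, instr_out, parMap_out, parMap_val,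
    attach_val, attach_out, parFilter_val, before_val]
  rw [parFilter_out (by simp), parFilter_out (by simp), sum_map_eq_zero (by simp),
    sum_map_eq_zero (by simp)]
  simp only [zero_add]
  rfl

lemma length_following_add_preceding (η : Fin n → ℕ) (A : Fin n → List (Fin n)) (v : Fin n) :
    (following η A v).length + (preceding η A v).length ≤ (A v).length := by
  rw [following, preceding, ← List.countP_eq_length_filter, ← List.countP_eq_length_filter]
  induction A v with
  | nil => simp
  | cons a l ih =>
    simp only [List.countP_cons, decide_eq_true_eq, List.length_cons]
    split_ifs with h1 h2
    · exfalso
      rcases h1 with h1 | h1 <;> rcases h2 with h2 | h2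
      · omega
      · omega
      · omega
      · exact lt_asymm h1.2 h2.2
    all_goals omega

lemma vertexCall_work_le {η : Fin n → ℕ} {A : Fin n → List (Fin n)} {D : ℕ}
    (hD : ∀ v, (following η A v).length ≤ D) (v : Fin n) :
    (vertexCall η (following η A) A v).work ≤
      8 + (A v).length * (17 + D * (9 + 6 * D)) +
      (bkPivot n ((following η A v).map (cand η A (following η A v))) [v]
        ((preceding η A v).map (cand η A (following η A v)))).work := by
  have h1 : ∀ p : Fin n → Comp (Finset (Fin n)) Bool, (∀ w, (p w).work = 3) →
      (parFilter p (A v)).work ≤ 2 + (A v).length * (3 + 3) := fun p hp =>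
    parFilter_work_le fun w _ => (hp w).le
  have h2 : ∀ l, (parMap (attach (following η A) (following η A v)) l).work ≤
      1 + l.length * (1 + (4 + D * (9 + 6 * D))) := fun l =>
    parMap_work_le fun w _ => attach_work_le hD (hD v) w
  have h3 := h1 (fun w => before η v w) fun w => rfl
  have h4 := h1 (fun w => before η w v) fun w => rfl
  have h5 := h2 (following η A v)
  have h6 := h2 (preceding η A v)
  have h7 := Nat.mul_le_mul_right (1 + (4 + D * (9 + 6 * D)))
    (length_following_add_preceding η A v)
  simp only [vertexCall, bind_work, instr_val, instr_work, parMap_val,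
    attach_val, parFilter_val, before_val]
  change 1 + (_ + (_ + ((parMap (attach (following η A) (following η A v))
    (following η A v)).work + ((parMap (attach (following η A) (following η A v))
    (preceding η A v)).work + (1 + (bkPivot n
      ((following η A v).map (cand η A (following η A v))) [v]
        ((preceding η A v).map (cand η A (following η A v)))).work))))) ≤ _
  linarith

lemma vertexCall_depth_le {η : Fin n → ℕ} {A : Fin n → List (Fin n)}
    (hA : ∀ v, (A v).length ≤ n) (v : Fin n) :
    (vertexCall η (following η A) A v).depth ≤ 42 + 18 * Nat.clog 2 n +
      (bkPivot n ((following η A v).map (cand η A (following η A v))) [v]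
        ((preceding η A v).map (cand η A (following η A v)))).depth := by
  have hf : ∀ v, (following η A v).length ≤ n := fun v =>
    (List.length_filter_le _ _).trans (hA v)
  have hp : ∀ v, (preceding η A v).length ≤ n := fun v =>
    (List.length_filter_le _ _).trans (hA v)
  have h1 : ∀ p : Fin n → Comp (Finset (Fin n)) Bool, (∀ w, (p w).depth = 3) →
      (parFilter p (A v)).depth ≤ 3 + 2 * Nat.clog 2 n + 3 := fun p hp =>
    parFilter_depth_le (hA v) fun w _ => (hp w).le
  have h2 : ∀ l, l.length ≤ n →
      (parMap (attach (following η A) (following η A v)) l).depth ≤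
        1 + Nat.clog 2 n + (13 + 6 * Nat.clog 2 n) := fun l hl =>
    parMap_depth_le hl fun w _ => attach_depth_le hf (hf v) w
  have h3 := h1 (fun w => before η v w) fun w => rfl
  have h4 := h1 (fun w => before η w v) fun w => rfl
  have h5 := h2 (following η A v) (hf v)
  have h6 := h2 (preceding η A v) (hp v)
  simp only [vertexCall, bind_depth, instr_val, instr_depth, parMap_val,
    attach_val, parFilter_val, before_val]
  change 1 + (_ + (_ + ((parMap (attach (following η A) (following η A v))
    (following η A v)).depth + ((parMap (attach (following η A) (following η A v))
    (preceding η A v)).depth + (1 + (bkPivot n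
      ((following η A v).map (cand η A (following η A v))) [v]
        ((preceding η A v).map (cand η A (following η A v)))).depth))))) ≤ _
  omega

lemma candInv_cand {G : SimpleGraph (Fin n)} {A : Fin n → List (Fin n)}
    (hA : IsAdjacencyArrays G A) (η : Fin n → ℕ) (v : Fin n) :
    CandInv G (following η A v).toFinset
      ((following η A v).map (cand η A (following η A v)))
      ((preceding η A v).map (cand η A (following η A v))) := by
  have hmem : ∀ {P l : List (Fin n)} {c : Cand n}, c ∈ l.map (cand η A P) →
      c = cand η A P c.vtx := by
    intro P l c hc
    obtain ⟨w, -, rfl⟩ := List.mem_map.1 hc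
    rfl
  constructor
  · rw [← List.map_append]
    refine List.Nodup.map (fun a b h => congrArg Cand.vtx h) ?_
    refine List.nodup_append'.2 ⟨(hA v).1.filter _, (hA v).1.filter _, fun w hw hw' => ?_⟩
    simp only [following, preceding, List.mem_filter, decide_eq_true_eq] at hw hw'
    have := @lt_asymm _ _ v w
    omega
  · intro c hc c' hc' h
    rw [← List.map_append] at hc hc'
    rw [hmem hc, hmem hc', h]
  · intro c hc
    obtain ⟨w, hw, rfl⟩ := List.mem_map.1 hc
    exact List.mem_toFinset.2 hw
  · intro c hc p hp
    rw [← List.map_append] at hc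
    rw [hmem hc]
    rw [List.mem_toFinset] at hp
    simp only [cand, List.mem_filter, hp, true_and, Bool.or_eq_true, decide_eq_true_eq]
    simp only [following, List.mem_filter, (hA _).2, decide_eq_true_eq, G.adj_comm p]
    constructor
    · tauto
    · intro h
      have := h.ne
      rcases lt_trichotomy (η c.vtx) (η p) with h1 | h1 | h1
      · tauto
      · rcases lt_or_gt_of_ne this with h2 | h2
        · tauto
        · have := h1.symm; tauto
      · tauto

lemma length_nbr_cand_le (η : Fin n → ℕ) (A : Fin n → List (Fin n)) (P l l' : List (Fin n)) :
    ∀ c ∈ l.map (cand η A P) ++ l'.map (cand η A P), c.nbr.length ≤ P.length := by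
  intro c hc
  rw [← List.map_append] at hc
  obtain ⟨w, -, rfl⟩ := List.mem_map.1 hc
  exact List.length_filter_le _ _

lemma IsAdjacencyArrays.length_lt {G : SimpleGraph (Fin n)} {A : Fin n → List (Fin n)}
    (hA : IsAdjacencyArrays G A) (v : Fin n) : (A v).length < n := by
  have h : (v :: A v).Nodup :=
    List.nodup_cons.2 ⟨fun h => G.loopless.irrefl v (((hA v).2 v).1 h), (hA v).1⟩
  simpa using h.length_le_card

lemma IsAdjacencyArrays.length_eq {G : SimpleGraph (Fin n)} {A : Fin n → List (Fin n)}
    (hA : IsAdjacencyArrays G A) (v : Fin n) : (A v).length = degOn G Finset.univ v := by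
  simpa using (adgInv_init hA).length_nbr (List.mem_finRange v)

lemma sum_length_adjacencyArrays {G : SimpleGraph (Fin n)} {A : Fin n → List (Fin n)}
    (hA : IsAdjacencyArrays G A) :
    ((List.finRange n).map fun v => (A v).length).sum = 2 * G.edgeSet.ncard := by
  rw [← sum_degOn_univ, ← List.sum_toFinset _ (List.nodup_finRange n), List.toFinset_finRange]
  exact Finset.sum_congr rfl fun v _ => hA.length_eq v

/-- The branches of the outermost loop report every maximal clique once. -/
lemma sum_vertexCall_out [NeZero n] {G : SimpleGraph (Fin n)} {A : Fin n → List (Fin n)}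
    (hA : IsAdjacencyArrays G A) (η : Fin n → ℕ) :
    ((List.finRange n).map fun v => (vertexCall η (following η A) A v).out).sum =
      (maximalCliques G).val := by
  classical
  have h1 : ∑ K ∈ restrictedCliques G Finset.univ ∅, ({K} : Multiset (Finset (Fin n))) =
      (maximalCliques G).val := by
    rw [restrictedCliques_univ, Finset.sum_multiset_singleton]
  rw [← h1, sum_restrictedCliques G (Finset.subset_univ Finset.univ)
    (f := fun v => toLex (η v, v)) fun a b h => (Prod.ext_iff.1 (toLex.injective h)).2]
  · rw [← List.sum_toFinset _ (List.nodup_finRange n), List.toFinset_finRange]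
    refine Finset.sum_congr rfl fun v _ => ?_
    rw [vertexCall_out, bkPivot_out G _ n _ _ _ (candInv_cand hA η v)
      (by rw [List.length_map]; exact (List.length_filter_le _ _).trans_lt (hA.length_lt v))]
    have hv : ∀ l : List (Fin n), vset (l.map (cand η A (following η A v))) = l.toFinset := by
      intro l
      rw [vset, List.map_map]
      congr 1
      exact List.map_id l
    rw [hv, hv]
    refine Finset.sum_congr ?_ fun K _ => by simp
    congr 1
    · ext w
      simp [following, (hA v).2, Prod.Lex.toLex_lt_toLex]
    · ext w
      simp [preceding, (hA v).2, Prod.Lex.toLex_lt_toLex]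
  · intro K hK
    obtain ⟨v, hv, -⟩ := exists_mem_not_adj_pivot hK (u := (0 : Fin n)) (by simp)
    exact ⟨v, by simp, hv⟩

end Outer

section Main

open Comp

variable {n : ℕ}

lemma bkADG_eq (ε : ℝ) (A : Fin n → List (Fin n)) : bkADG ε A = (do
    let η ← adg (ε / 2) A
    let V ← vertices n
    let out ← store V (fun v => do
      let Nv ← instr (A v)
      parFilter (fun w => before η v w) Nv) (fun _ => [])
    let _ ← parMap (vertexCall η out A) V
    pure ()) := rfl

/-- The loop that computes the arrays of the following neighbours. -/
def storeFollowing (η : Fin n → ℕ) (A : Fin n → List (Fin n)) :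
    Comp (Finset (Fin n)) (Fin n → List (Fin n)) :=
  store (List.finRange n) (fun v => do
      let Nv ← instr (A v)
      parFilter (fun w => before η v w) Nv) (fun _ => [])

lemma storeFollowing_val (η : Fin n → ℕ) (A : Fin n → List (Fin n)) :
    (storeFollowing η A).val = following η A := by
  funext v
  simp [storeFollowing, following]

lemma storeFollowing_out (η : Fin n → ℕ) (A : Fin n → List (Fin n)) :
    (storeFollowing η A).out = 0 := by
  simp only [storeFollowing, store_out, bind_out, instr_out, zero_add]
  exact sum_map_eq_zero fun v _ => parFilter_out (by simp)

lemma storeFollowing_work_le {G : SimpleGraph (Fin n)} {A : Fin n → List (Fin n)}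
    (hA : IsAdjacencyArrays G A) (η : Fin n → ℕ) :
    (storeFollowing η A).work ≤ 1 + 5 * n + 12 * G.edgeSet.ncard := by
  have h1 : ∀ v ∈ List.finRange n, (do
      let Nv ← instr (A v)
      parFilter (fun w => before η v w) Nv : Comp (Finset (Fin n)) _).work ≤
        3 + 6 * (A v).length := fun v _ => by
    have : (parFilter (fun w => before η v w) (A v) : Comp (Finset (Fin n)) _).work ≤
      2 + (A v).length * (3 + 3) := parFilter_work_le fun w _ => by simp
    simp only [bind_work, instr_work, instr_val]
    omega
  have h2 := List.sum_le_sum h1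
  rw [sum_map_const_add, List.sum_map_mul_left, sum_length_adjacencyArrays hA,
    List.length_finRange] at h2
  rw [storeFollowing, store_work, List.length_finRange]
  omega

lemma storeFollowing_depth_le {A : Fin n → List (Fin n)} (hA : ∀ v, (A v).length ≤ n)
    (η : Fin n → ℕ) : (storeFollowing η A).depth ≤ 9 + 3 * Nat.clog 2 n := by
  have : (storeFollowing η A).depth ≤ 2 + Nat.clog 2 n + (7 + 2 * Nat.clog 2 n) := by
    refine store_depth_le (by simp) fun v _ => ?_
    have : (parFilter (fun w => before η v w) (A v) : Comp (Finset (Fin n)) _).depth ≤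
      3 + 2 * Nat.clog 2 n + 3 := parFilter_depth_le (hA v) fun w _ => by simp
    simp only [bind_depth, instr_depth, instr_val]
    omega
  omega

lemma bkADG_out [NeZero n] {G : SimpleGraph (Fin n)} {A : Fin n → List (Fin n)}
    (hA : IsAdjacencyArrays G A) (ε : ℝ) : (bkADG ε A).out = (maximalCliques G).val := by
  rw [bkADG_eq]
  simp only [bind_out, adg_out, vertices_out, vertices_val, pure_out, add_zero, zero_add]
  change (storeFollowing _ A).out + (parMap (vertexCall _ (storeFollowing _ A).val A) _).out = _
  rw [storeFollowing_out, storeFollowing_val, zero_add, parMap_out]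
  exact sum_vertexCall_out hA _

lemma bkADG_work_eq (ε : ℝ) (A : Fin n → List (Fin n)) :
    (bkADG ε A).work = (adg (ε / 2) A : Comp (Finset (Fin n)) _).work + ((1 + n) +
      ((storeFollowing (adg (ε / 2) A : Comp (Finset (Fin n)) _).val A).work + (1 + n +
        ((List.finRange n).map fun v =>
          (vertexCall (adg (ε / 2) A : Comp (Finset (Fin n)) _).val
            (following (adg (ε / 2) A : Comp (Finset (Fin n)) _).val A) A v).work).sum))) := by
  rw [bkADG_eq, ← storeFollowing_val]
  simp only [bind_work, vertices_work, vertices_val, pure_work, add_zero, parMap_work,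
    List.length_finRange]
  rfl

lemma bkADG_depth_eq (ε : ℝ) (A : Fin n → List (Fin n)) :
    (bkADG ε A).depth = (adg (ε / 2) A : Comp (Finset (Fin n)) _).depth + ((1 + Nat.clog 2 n) +
      ((storeFollowing (adg (ε / 2) A : Comp (Finset (Fin n)) _).val A).depth +
        (parMap (vertexCall (adg (ε / 2) A : Comp (Finset (Fin n)) _).val
          (following (adg (ε / 2) A : Comp (Finset (Fin n)) _).val A)
            A) (List.finRange n)).depth)) := by
  rw [bkADG_eq, ← storeFollowing_val]
  simp only [bind_depth, vertices_depth, vertices_val, pure_depth, add_zero]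
  rfl

/-- The order by rank is a `(2 + ε)`-approximate degeneracy order. -/
lemma length_following_le {G : SimpleGraph (Fin n)} {A : Fin n → List (Fin n)}
    (hA : IsAdjacencyArrays G A) {ε : ℝ} (hε : 0 < ε) (v : Fin n) :
    ((following (adg (ε / 2) A : Comp (Finset (Fin n)) _).val A v).length : ℝ) ≤
      (2 + ε) * degeneracy G := by
  classical
  rw [adg_val]
  set η := (adgLoop (ε / 2) n 1 (List.finRange n) A (fun _ => 0) : Comp (Finset (Fin n)) _).val
    with hη
  have h1 := ((adgLoop_rank (ω := Finset (Fin n)) (half_pos hε) n 1 _ _ _ (adgInv_init hA)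
    (by simp)).2 v (List.mem_finRange v)).2
  rw [← hη] at h1
  have h2 : (following η A v).length ≤
      (Finset.univ.filter fun w => G.Adj v w ∧ η v ≤ η w).card := by
    have hnd : (following η A v).Nodup := (hA v).1.filter _
    rw [← List.toFinset_card_of_nodup hnd]
    refine Finset.card_le_card fun w hw => ?_
    simp only [following, List.mem_toFinset, List.mem_filter, (hA v).2, decide_eq_true_eq,
      Finset.mem_filter, Finset.mem_univ, true_and] at hw ⊢
    exact ⟨hw.1, by omega⟩
  exact (Nat.cast_le.2 h2).trans ((le_of_eq (by congr!)).trans (h1.trans_eq (by ring)))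

/-- The work of one branch of the outermost loop, if every vertex is followed by at most `D`
neighbours. -/
lemma vertexCall_work_le_mul {G : SimpleGraph (Fin n)} {A : Fin n → List (Fin n)}
    (hA : IsAdjacencyArrays G A) {η : Fin n → ℕ} {D : ℕ}
    (hD : ∀ v, (following η A v).length ≤ D) {S : ℝ} (hS : ∀ p, levelSum p ≤ S) (v : Fin n) :
    ((vertexCall η (following η A) A v).work : ℝ) ≤
      (100 + 100 * S) * ((D + 1) * cbrtThree ^ D) * ((A v).length + 1) := by
  have h0 : 0 < cbrtThree := by linarith [one_lt_cbrtThree]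
  have h1 := vertexCall_work_le hD v
  have hlen := length_following_add_preceding η A v
  have h2 := bkPivot_work_le (A v).length D n _ [v] _ (candInv_cand hA η v)
    (by simpa using hlen)
    (fun c hc => (length_nbr_cand_le η A _ _ _ c hc).trans (hD v))
    (by have := hD v; simp; omega)
  rw [List.length_map] at h2
  set W := (bkPivot n ((following η A v).map (cand η A (following η A v))) [v]
        ((preceding η A v).map (cand η A (following η A v)))).work
  set k := (A v).length
  set p := (following η A v).length
  have hS0 : 1 ≤ S := (one_le_levelSum 0).trans (hS 0)
  have h3 : cbrtThree ^ p * levelSum p ≤ cbrtThree ^ D * S :=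
    mul_le_mul (pow_le_pow_right₀ one_lt_cbrtThree.le (hD v)) (hS p)
      (by linarith [one_le_levelSum p]) (by positivity)
  have h4 : (W : ℝ) ≤ 100 * ((k + 1) * (D + 1)) * (cbrtThree ^ D * S) :=
    h2.trans (mul_le_mul_of_nonneg_left h3 (by positivity))
  have h5 : ((D : ℝ) + 1) ≤ 3 * cbrtThree ^ D := by
    have h := natCast_le_cbrtThree_pow (D + 1)
    have h' : cbrtThree ≤ 3 := by
      have := one_lt_cbrtThree
      rw [← cbrtThree_pow_three]
      nlinarith [sq_nonneg (cbrtThree - 1)]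
    rw [pow_succ] at h
    push_cast at h
    nlinarith [pow_pos h0 D]
  have h6 : ((8 + k * (17 + D * (9 + 6 * D)) : ℕ) : ℝ) ≤
      33 * ((k + 1) * (D + 1)) * (D + 1) := by
    have : 8 + k * (17 + D * (9 + 6 * D)) ≤ 33 * ((k + 1) * (D + 1)) * (D + 1) := by
      nlinarith [Nat.zero_le (k * D * D), Nat.zero_le (k * D), Nat.zero_le k, Nat.zero_le D,
        Nat.zero_le (D * D)]
    exact_mod_cast this
  have h7 : 33 * (((k : ℝ) + 1) * (D + 1)) * (D + 1) ≤
      33 * ((k + 1) * (D + 1)) * (3 * cbrtThree ^ D) :=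
    mul_le_mul_of_nonneg_left h5 (by positivity)
  have h8 : ((vertexCall η (following η A) A v).work : ℝ) ≤
      ((8 + k * (17 + D * (9 + 6 * D)) : ℕ) : ℝ) + W := by exact_mod_cast h1
  have h9 : 0 ≤ ((k : ℝ) + 1) * (D + 1) * cbrtThree ^ D := by positivity
  linarith

lemma clog_two_add_one_le (hn : 2 ≤ n) : (Nat.clog 2 n + 1 : ℝ) ≤ 6 * Real.log n := by
  have h1 : Nat.clog 2 n ≤ Nat.log 2 n + 1 := Nat.clog_le_of_le_pow
    (Nat.lt_pow_succ_log_self (by norm_num) n).le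
  have h2 : (2 : ℝ) ^ Nat.log 2 n ≤ n := by exact_mod_cast Nat.pow_log_le_self 2 (by omega)
  have h3 := Real.log_le_log (by positivity) h2
  rw [Real.log_pow] at h3
  have h4 : Real.log 2 ≤ Real.log n := Real.log_le_log (by norm_num) (by exact_mod_cast hn)
  have h5 := Real.log_two_gt_d9
  have h6 : (Nat.clog 2 n : ℝ) ≤ Nat.log 2 n + 1 := by exact_mod_cast h1
  have h7 : (Nat.log 2 n : ℝ) * 0.69 ≤ Real.log n := by
    have : (Nat.log 2 n : ℝ) * 0.69 ≤ Nat.log 2 n * Real.log 2 :=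
      mul_le_mul_of_nonneg_left (by linarith) (Nat.cast_nonneg _)
    linarith
  linarith

lemma bkADG_depth_le {G : SimpleGraph (Fin n)} {A : Fin n → List (Fin n)}
    (hA : IsAdjacencyArrays G A) {ε : ℝ} (hε : 0 < ε) (hn : 2 ≤ n) :
    ((bkADG ε A).depth : ℝ) ≤ (10000 + 1000 * ε + 600 / Real.log (1 + ε / 2)) *
      (Real.log n ^ 2 + (degeneracy G : ℝ) * Real.log n) := by
  set η := (adg (ε / 2) A : Comp (Finset (Fin n)) _).val with hη
  set D := ⌊(2 + ε) * (degeneracy G : ℝ)⌋₊ with hD'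
  have hD : ∀ v, (following η A v).length ≤ D := fun v => Nat.le_floor (length_following_le hA hε v)
  have hDle : (D : ℝ) ≤ (2 + ε) * degeneracy G := Nat.floor_le (by positivity)
  have hlen : ∀ v, (A v).length ≤ n := fun v => (hA.length_lt v).le
  set L := Nat.clog 2 n + 1 with hL
  have hLle : (L : ℝ) ≤ 6 * Real.log n := by
    have := clog_two_add_one_le hn
    rw [hL]; push_cast; exact this
  have h1 : ∀ v, (vertexCall η (following η A) A v).depth ≤ 46 * L + (D + 1) * (100 * L) + D :=
    fun v => by
    have h2 := vertexCall_depth_le (η := η) hlen v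
    have h3 := bkPivot_depth_le n n _ [v] _ (candInv_cand hA η v)
      (by simpa using (length_following_add_preceding η A v).trans (hlen v))
      (fun c hc => (length_nbr_cand_le η A _ _ _ c hc).trans
        ((List.length_filter_le _ _).trans (hlen v)))
    rw [List.length_map, ← hL] at h3
    have h4 := hD v
    have h5 : ((following η A v).length + 1) * (100 * L) ≤ (D + 1) * (100 * L) :=
      Nat.mul_le_mul_right _ (by omega)
    simp only [List.length_cons, List.length_nil] at h3
    omega
  have h2 : (parMap (vertexCall η (following η A) A) (List.finRange n)).depth ≤
      1 + Nat.clog 2 n + (46 * L + (D + 1) * (100 * L) + D) :=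
    parMap_depth_le (by simp) fun v _ => h1 v
  have h3 := storeFollowing_depth_le hlen η
  have h4 := adg_depth_le (ω := Finset (Fin n)) (ε / 2) A
  have h5 := adgLoop_depth_le (ω := Finset (Fin n)) (half_pos hε) n 1 _ _ _ (adgInv_init hA)
  have h6 := bkADG_depth_eq ε A
  rw [← hη] at h6
  set T := (adgLoop (ε / 2) n 1 (List.finRange n) A (fun _ => 0) : Comp (Finset (Fin n)) _).depth
  have h7 : (bkADG ε A).depth ≤ 200 * L + D * (101 * L) + T := by
    rw [add_mul] at h2
    have : D ≤ D * L := Nat.le_mul_of_pos_right D (by omega)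
    have e : D * (101 * L) = D * (100 * L) + D * L := by ring
    omega
  have h8 : ((bkADG ε A).depth : ℝ) ≤ 200 * L + D * (101 * L) + T := by exact_mod_cast h7
  rw [List.length_finRange] at h5
  have hLc : (Nat.clog 2 n + 1 : ℝ) = L := by rw [hL]; push_cast; rfl
  rw [hLc] at h5
  set ℓ := Real.log n with hℓ
  have hℓ1 : 1 / 2 ≤ ℓ := by
    have h4 : Real.log 2 ≤ Real.log n := Real.log_le_log (by norm_num) (by exact_mod_cast hn)
    linarith [Real.log_two_gt_d9]
  have hlog : 0 < Real.log (1 + ε / 2) := Real.log_pos (by linarith)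
  set d : ℝ := (degeneracy G : ℝ)
  have hd0 : 0 ≤ d := Nat.cast_nonneg _
  have hsq : ℓ ≤ 2 * ℓ ^ 2 := by nlinarith
  have h9 : (100 * L : ℝ) * (ℓ / Real.log (1 + ε / 2) + 1) ≤
      600 * ℓ * (ℓ / Real.log (1 + ε / 2) + 1) :=
    mul_le_mul_of_nonneg_right (by linarith) (by positivity)
  have h10 : (D : ℝ) * (101 * L) ≤ (2 + ε) * d * (101 * (6 * ℓ)) :=
    mul_le_mul hDle (by linarith) (by positivity) (by positivity)
  have h11 : 600 * ℓ * (ℓ / Real.log (1 + ε / 2) + 1) =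
      600 / Real.log (1 + ε / 2) * ℓ ^ 2 + 600 * ℓ := by
    field_simp
  have h12 : 0 ≤ 600 / Real.log (1 + ε / 2) * (d * ℓ) := by positivity
  have h13 : 0 ≤ ε * ℓ ^ 2 := by positivity
  have h14 : 0 ≤ ε * (d * ℓ) := by positivity
  have h15 : 0 ≤ d * ℓ := by positivity
  linarith

lemma bkADG_work_le {G : SimpleGraph (Fin n)} {A : Fin n → List (Fin n)}
    (hA : IsAdjacencyArrays G A) {ε : ℝ} (hε : 0 < ε) (hn : 2 ≤ n) {c : ℝ}
    (hc : (n : ℝ) ≤ c * (G.edgeSet.ncard : ℝ)) {S : ℝ} (hS : ∀ p, levelSum p ≤ S) :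
    ((bkADG ε A).work : ℝ) ≤
      (100 + 100 * c + 100 * ((1 + ε / 2) / (ε / 2)) * c +
        (100 + 100 * S) * (3 + ε) * (2 + c)) *
      ((degeneracy G : ℝ) * (G.edgeSet.ncard : ℝ) *
        (3 : ℝ) ^ ((2 + ε) * (degeneracy G : ℝ) / 3)) := by
  set η := (adg (ε / 2) A : Comp (Finset (Fin n)) _).val with hη
  set D := ⌊(2 + ε) * (degeneracy G : ℝ)⌋₊ with hD'
  have hD : ∀ v, (following η A v).length ≤ D := fun v => Nat.le_floor (length_following_le hA hε v)
  have hDle : (D : ℝ) ≤ (2 + ε) * degeneracy G := Nat.floor_le (by positivity)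
  have hdeg := ncard_edgeSet_le G
  rw [Fintype.card_fin] at hdeg
  have h1 : ((((List.finRange n).map fun v => (vertexCall η (following η A) A v).work).sum : ℕ) : ℝ)
      ≤ (100 + 100 * S) * ((D + 1) * cbrtThree ^ D) * (2 * G.edgeSet.ncard + n) := by
    rw [← Nat.cast_ofNat (R := ℝ) (n := 2), ← Nat.cast_mul, ← sum_length_adjacencyArrays hA]
    rw [Nat.cast_list_sum, Nat.cast_list_sum, List.map_map, List.map_map]
    refine (List.sum_le_sum (g := fun v => (100 + 100 * S) * ((D + 1) * cbrtThree ^ D) *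
      (((A v).length : ℝ) + 1)) fun v _ => vertexCall_work_le_mul hA hD hS v).trans ?_
    rw [List.sum_map_mul_left, List.sum_map_add]
    simp [Function.comp_def]
  have h2 := storeFollowing_work_le hA η
  have h3 := adg_work (ω := Finset (Fin n)) (ε / 2) A
  have h4 := adgLoop_work_le (ω := Finset (Fin n)) (half_pos hε) n 1 _ _ _ (adgInv_init hA)
  have h5 := bkADG_work_eq ε A
  rw [← hη] at h5
  rw [List.length_finRange] at h4
  set T := (adgLoop (ε / 2) n 1 (List.finRange n) A (fun _ => 0) : Comp (Finset (Fin n)) _).work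
  set W := ((List.finRange n).map fun v => (vertexCall η (following η A) A v).work).sum
  set m := G.edgeSet.ncard
  set d := degeneracy G
  set E : ℝ := (3 : ℝ) ^ ((2 + ε) * (d : ℝ) / 3) with hE
  have hn' : (2 : ℝ) ≤ n := by exact_mod_cast hn
  have hm : 1 ≤ m := by
    rcases Nat.eq_zero_or_pos m with h | h
    · rw [h] at hc; norm_num at hc; linarith
    · exact h
  have hd : 1 ≤ d := by
    rcases Nat.eq_zero_or_pos d with h | h
    · rw [h] at hdeg; omega
    · exact h
  have hm' : (1 : ℝ) ≤ m := by exact_mod_cast hm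
  have hd' : (1 : ℝ) ≤ d := by exact_mod_cast hd
  have hc0 : 0 < c := by
    by_contra! h
    nlinarith
  have hE1 : 1 ≤ E := Real.one_le_rpow (by norm_num) (by positivity)
  have hDE : cbrtThree ^ D ≤ E := by
    rw [cbrtThree_pow, hE]
    exact Real.rpow_le_rpow_of_exponent_le (by norm_num) (by gcongr)
  have hS0 : 1 ≤ S := (one_le_levelSum 0).trans (hS 0)
  have hZ : (m : ℝ) ≤ d * m * E := by
    calc (m : ℝ) = 1 * m * 1 := by ring
      _ ≤ d * m * E := by gcongr
  have hdm : (d : ℝ) * m ≤ d * m * E := le_mul_of_one_le_right (by positivity) hE1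
  have hnZ : (n : ℝ) ≤ c * (d * m * E) := hc.trans (by gcongr)
  have hdn : ((d : ℝ) + 1) * n ≤ 2 * c * (d * m * E) := by
    calc ((d : ℝ) + 1) * n ≤ (2 * d) * (c * m) := by gcongr; linarith
      _ = 2 * c * (d * m) := by ring
      _ ≤ _ := by gcongr
  have h6 : (T : ℝ) ≤ 100 * ((1 + ε / 2) / (ε / 2)) * c * (d * m * E) + 1 := by
    have := mul_le_mul_of_nonneg_left hdn
      (show 0 ≤ 50 * ((1 + ε / 2) / (ε / 2)) by positivity)
    linarith
  have h0 : 0 < cbrtThree := by linarith [one_lt_cbrtThree]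
  have h7 : (W : ℝ) ≤ (100 + 100 * S) * (3 + ε) * (2 + c) * (d * m * E) := by
    refine h1.trans ?_
    calc _ ≤ (100 + 100 * S) * (((3 + ε) * d) * E) * ((2 + c) * m) := by
          gcongr
          · linarith
          · linarith
      _ = _ := by ring
  have h8 : (bkADG ε A).work ≤ 14 * n + 6 + 12 * m + T + W := by omega
  have h9 : ((bkADG ε A).work : ℝ) ≤ 14 * n + 6 + 12 * m + T + W := by exact_mod_cast h8
  have h10 : 0 ≤ c * (d * m * E) := by positivity
  linarith

end Main

theorem mainTheorem1 (ε : ℝ) (hε : 0 < ε) (c : ℝ) :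
    ∃ C : ℝ, ∀ (n : ℕ) (G : SimpleGraph (Fin n)) (A : Fin n → List (Fin n)),
      2 ≤ n → IsAdjacencyArrays G A →
        (bkADG ε A).out = (maximalCliques G).val ∧
        ((n : ℝ) ≤ c * (G.edgeSet.ncard : ℝ) →
          ((bkADG ε A).work : ℝ) ≤ C * ((degeneracy G : ℝ) * (G.edgeSet.ncard : ℝ) *
            (3 : ℝ) ^ ((2 + ε) * (degeneracy G : ℝ) / 3))) ∧
        ((bkADG ε A).depth : ℝ) ≤
          C * (Real.log n ^ 2 + (degeneracy G : ℝ) * Real.log n) := by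
  obtain ⟨S, hS⟩ := exists_levelSum_le
  refine ⟨max (100 + 100 * c + 100 * ((1 + ε / 2) / (ε / 2)) * c +
        (100 + 100 * S) * (3 + ε) * (2 + c))
    (10000 + 1000 * ε + 600 / Real.log (1 + ε / 2)), fun n G A hn hA => ⟨?_, fun hc => ?_, ?_⟩⟩
  · have : NeZero n := ⟨by omega⟩
    exact bkADG_out hA ε
  · exact (bkADG_work_le hA hε hn hc hS).trans
      (mul_le_mul_of_nonneg_right (le_max_left _ _) (by positivity))
  · have := Real.log_natCast_nonneg n
    exact (bkADG_depth_le hA hε hn).trans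
      (mul_le_mul_of_nonneg_right (le_max_right _ _) (by positivity))
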